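/- Let $\widetilde M(\mu)$ be a complex space form of real dimension $2m$, i.e. a Kähler manifold, with metric $g$, parallel complex structure $J$ and Levi-Civita connection $\widetilde\nabla$, of constant holomorphic sectional curvature $\mu\in\mathbb R$. Let $M$ be an $n$-dimensional ($n>1$) immersed submanifold of $\widetilde M(\mu)$ with the induced metric. For tangent fields $X,Y$ and normal fields $\xi$ on $M$ let $\sigma(X,Y)$ be the normal component of $\widetilde\nabla_XY$ (the second fundamental form), let $-A_\xi X$ and $D_X\xi$ be the tangential and the normal component of $\widetilde\nabla_X\xi$, let $f\xi$ be the normal component of $J\xi$, let $H=\frac1n\operatorname{tr}\sigma$ be the mean curvature vector, and let $R^\perp(X,Y)\xi=D_XD_Y\xi-D_YD_X\xi-D_{[X,Y]}\xi$. Assume that 1. $M$ is totally real: $J T_pM\subset T_pM^\perp$ for every $p\in M$; 2. $M$ has commutative second fundamental forms: $A_\xi A_\eta=A_\eta A_\xi$ for all normal vector fields $\xi,\eta$; 3. the $f$-structure in the normal bundle is parallel: $D_X(f\xi)=f(D_X\xi)$ for all tangent fields $X$ and normal fields $\xi$ (the case $f=0$ is allowed); 4. the mean curvature vector is semiparallel: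 $R^\perp(X,Y)H=0$ for all tangent fields $X,Y$. Then $M$ is totally geodesic, i.e. $\sigma=0$, or $\mu=0$. -/

import Mathlib

open Bundle Module VectorField
open scoped Manifold ContDiff Topology RealInnerProductSpace

noncomputable section

/-! ### Kähler manifolds and complex space forms -/

section Ambient

variable {E : Type*} [NormedAddCommGroup E] [NormedSpace ℝ E] [FiniteDimensional ℝ E]
  {H : Type*} [TopologicalSpace H] {I : ModelWithCorners ℝ E H}
  {N : Type*} [TopologicalSpace N] [ChartedSpace H N] [IsManifold I ∞ N]

/-- `X` is a smooth vector field on `N`. -/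
def IsSmoothField (X : Π x : N, TangentSpace I x) : Prop :=
  ContMDiff I I.tangent ∞ (fun x ↦ (⟨x, X x⟩ : TangentBundle I N))

/-- `cov` is the Levi-Civita connection of the Riemannian manifold `N`: the smooth affine
connection which is torsion free and metric. Recall that `cov Y x v` is `∇_v Y` at `x`. -/
structure IsLeviCivita [RiemannianBundle (fun x : N ↦ TangentSpace I x)]
    [IsContMDiffRiemannianBundle I ∞ E (fun x : N ↦ TangentSpace I x)]
    (cov : CovariantDerivative I E (fun x : N ↦ TangentSpace I x)) : Prop where
  smooth : CovariantDerivative.ContMDiffCovariantDerivative cov ∞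
  torsion_free : cov.torsion = 0
  metric : ∀ (Y Z : Π x : N, TangentSpace I x) (x : N),
    MDifferentiableAt I I.tangent (fun y ↦ (⟨y, Y y⟩ : TangentBundle I N)) x →
    MDifferentiableAt I I.tangent (fun y ↦ (⟨y, Z y⟩ : TangentBundle I N)) x →
    ∀ v : TangentSpace I x, mvfderiv I (fun y ↦ ⟪Y y, Z y⟫) x v
      = ⟪cov Y x v, Z x⟫ + ⟪Y x, cov Z x v⟫

/-- The curvature of an affine connection on vector fields:
`R(X, Y) Z = ∇_X ∇_Y Z - ∇_Y ∇_X Z - ∇_{[X, Y]} Z`. -/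
def affineCurvature (cov : CovariantDerivative I E (fun x : N ↦ TangentSpace I x))
    (X Y Z : Π x : N, TangentSpace I x) (x : N) : TangentSpace I x :=
  cov (fun y ↦ cov Z y (Y y)) x (X x) - cov (fun y ↦ cov Z y (X y)) x (Y x)
    - cov Z x (mlieBracket I X Y x)

/-- `J` is a Kähler structure on the Riemannian manifold `N` with Levi-Civita connection `cov`: a
smooth field of endomorphisms of the tangent spaces with `J² = -1`, orthogonal for the metric, and
parallel, `∇_v (J Y) = J ∇_v Y`. -/
structure IsKaehlerStructure [RiemannianBundle (fun x : N ↦ TangentSpace I x)]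
    (cov : CovariantDerivative I E (fun x : N ↦ TangentSpace I x))
    (J : Π x : N, TangentSpace I x →L[ℝ] TangentSpace I x) : Prop where
  smooth : ContMDiff I (I.prod 𝓘(ℝ, E →L[ℝ] E)) ∞
    (fun x ↦ (⟨x, J x⟩ : TotalSpace (E →L[ℝ] E)
      (fun x : N ↦ TangentSpace I x →L[ℝ] TangentSpace I x)))
  sq : ∀ (x : N) (v : TangentSpace I x), J x (J x v) = -v
  orthogonal : ∀ (x : N) (v w : TangentSpace I x), ⟪J x v, J x w⟫ = ⟪v, w⟫
  parallel : ∀ Y : Π x : N, TangentSpace I x, IsSmoothField Y →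
    ∀ (x : N) (v : TangentSpace I x), cov (fun y ↦ J y (Y y)) x v = J x (cov Y x v)

/-- `N` has constant holomorphic sectional curvature `μ`:
`g(R(X, JX) JX, X) = μ g(X, X)²` for all `X`. -/
def HasConstantHolomorphicCurvature [RiemannianBundle (fun x : N ↦ TangentSpace I x)]
    (cov : CovariantDerivative I E (fun x : N ↦ TangentSpace I x))
    (J : Π x : N, TangentSpace I x →L[ℝ] TangentSpace I x) (μ : ℝ) : Prop :=
  ∀ X : Π x : N, TangentSpace I x, IsSmoothField X → ∀ x : N,
    ⟪affineCurvature cov X (fun y ↦ J y (X y)) (fun y ↦ J y (X y)) x, X x⟫ = μ * ⟪X x, X x⟫ ^ 2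

/-- `N`, with Levi-Civita connection `cov` and complex structure `J`, is a complex space form of
constant holomorphic sectional curvature `μ`. -/
structure IsComplexSpaceForm [RiemannianBundle (fun x : N ↦ TangentSpace I x)]
    [IsContMDiffRiemannianBundle I ∞ E (fun x : N ↦ TangentSpace I x)]
    (cov : CovariantDerivative I E (fun x : N ↦ TangentSpace I x))
    (J : Π x : N, TangentSpace I x →L[ℝ] TangentSpace I x) (μ : ℝ) : Prop where
  leviCivita : IsLeviCivita cov
  kaehler : IsKaehlerStructure cov J
  holomorphicCurvature : HasConstantHolomorphicCurvature cov J μ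

end Ambient

/-! ### Immersed submanifolds -/

section Submanifold

variable {E : Type*} [NormedAddCommGroup E] [NormedSpace ℝ E] [FiniteDimensional ℝ E]
  {H : Type*} [TopologicalSpace H] {I : ModelWithCorners ℝ E H}
  {M : Type*} [TopologicalSpace M] [ChartedSpace H M] [IsManifold I ∞ M]
  {E' : Type*} [NormedAddCommGroup E'] [NormedSpace ℝ E'] [FiniteDimensional ℝ E']
  {H' : Type*} [TopologicalSpace H'] {I' : ModelWithCorners ℝ E' H'}
  {N : Type*} [TopologicalSpace N] [ChartedSpace H' N] [IsManifold I' ∞ N]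

instance finiteDimensional_tangentSpace (x : M) : FiniteDimensional ℝ (TangentSpace I x) :=
  inferInstanceAs (FiniteDimensional ℝ E)

variable (I I') in
/-- `ξ` is a smooth vector field along `φ`, i.e. a smooth section of `φ^* TN`. -/
def IsSmoothAlong (φ : M → N) (ξ : Π p : M, TangentSpace I' (φ p)) : Prop :=
  ContMDiff I I'.tangent ∞ (fun p ↦ (⟨φ p, ξ p⟩ : TangentBundle I' N))

variable (I) in
/-- The covariant derivative `∇_v ξ` of a field `ξ` along `φ`, for `v ∈ T_p M`.
Read the tangent bundle of `N` in the trivialization around `φ p`, so that `ξ = ∑ ξⁱ (Eᵢ ∘ φ)` with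
`Eᵢ` the frame given by the trivialization; then
`∇_v ξ = ∑ (dξⁱ v) Eᵢ + ∑ ξⁱ(p) ∇_{dφ v} Eᵢ`.
The second sum is the derivative of the field `∑ ξⁱ(p) Eᵢ` with constant components, which is
`FiberBundle.extend E' (ξ p)`. -/
def covAlong (cov : CovariantDerivative I' E' (fun x : N ↦ TangentSpace I' x)) (φ : M → N)
    (ξ : Π p : M, TangentSpace I' (φ p)) (p : M) (v : TangentSpace I p) :
    TangentSpace I' (φ p) :=
  let e := trivializationAt E' (fun x : N ↦ TangentSpace I' x) (φ p)
  e.symm (φ p) (mvfderiv I (fun q ↦ (e ⟨φ q, ξ q⟩).2) p v)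
    + cov (FiberBundle.extend E' (ξ p)) (φ p) (mfderiv I I' φ p v)

variable [RiemannianBundle (fun x : M ↦ TangentSpace I x)]
  [RiemannianBundle (fun x : N ↦ TangentSpace I' x)]

variable (I I') in
/-- `φ : M → N` makes `M` an immersed submanifold of `N` with the induced metric. (An isometric
differential is injective.) -/
structure IsIsometricImmersion (φ : M → N) : Prop where
  smooth : ContMDiff I I' ∞ φ
  isometric : ∀ (p : M) (v w : TangentSpace I p),
    ⟪mfderiv I I' φ p v, mfderiv I I' φ p w⟫ = ⟪v, w⟫

variable (I I') in
/-- The tangential component, as a vector of `T_p M`, of a vector of `T_{φ p} N`: for an isometric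
immersion the adjoint of `dφ` is the orthogonal projection onto `T_p M`. -/
def tangentialPart (φ : M → N) (p : M) : TangentSpace I' (φ p) →ₗ[ℝ] TangentSpace I p :=
  LinearMap.adjoint (mfderiv I I' φ p : TangentSpace I p →ₗ[ℝ] TangentSpace I' (φ p))

variable (I I') in
/-- The normal component of a vector of `T_{φ p} N`. -/
def normalPart (φ : M → N) (p : M) (w : TangentSpace I' (φ p)) : TangentSpace I' (φ p) :=
  w - mfderiv I I' φ p (tangentialPart I I' φ p w)

variable (I I') in
/-- `ξ` is a smooth normal vector field. -/
structure IsNormalField (φ : M → N) (ξ : Π p : M, TangentSpace I' (φ p)) : Prop where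
  smooth : IsSmoothAlong I I' φ ξ
  normal : ∀ (p : M) (v : TangentSpace I p), ⟪ξ p, mfderiv I I' φ p v⟫ = 0

variable (cov : CovariantDerivative I' E' (fun x : N ↦ TangentSpace I' x)) (φ : M → N)

/-- The second fundamental form `σ(v, w)`, by the Gauss formula the normal component of `∇_v W`,
where `W` is an extension of `w` to a vector field on `M` that is smooth around `p`. -/
def secondFundamentalForm (p : M) (v w : TangentSpace I p) : TangentSpace I' (φ p) :=
  normalPart I I' φ p
    (covAlong I cov φ (fun q ↦ mfderiv I I' φ q (FiberBundle.extend E w q)) p v)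

variable (I) in
/-- The mean curvature vector `H = (1 / n) tr σ`, where `n = dim M`. -/
def meanCurvature (p : M) : TangentSpace I' (φ p) :=
  (finrank ℝ E : ℝ)⁻¹ • ∑ i, secondFundamentalForm cov φ p
    (stdOrthonormalBasis ℝ (TangentSpace I p) i) (stdOrthonormalBasis ℝ (TangentSpace I p) i)

/-- The shape operator `A_ξ` of a normal field `ξ`, by the Weingarten formula: `-A_ξ v` is the
tangential component of `∇_v ξ`. -/
def shapeOperator (ξ : Π p : M, TangentSpace I' (φ p)) (p : M) (v : TangentSpace I p) :
    TangentSpace I p :=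
  -tangentialPart I I' φ p (covAlong I cov φ ξ p v)

/-- The normal connection: `D_v ξ` is the normal component of `∇_v ξ`. -/
def normalConnection (ξ : Π p : M, TangentSpace I' (φ p)) (p : M) (v : TangentSpace I p) :
    TangentSpace I' (φ p) :=
  normalPart I I' φ p (covAlong I cov φ ξ p v)

/-- The curvature of the normal connection:
`R^⊥(X, Y) ξ = D_X D_Y ξ - D_Y D_X ξ - D_{[X, Y]} ξ`. -/
def normalCurvature (X Y : Π p : M, TangentSpace I p) (ξ : Π p : M, TangentSpace I' (φ p))
    (p : M) : TangentSpace I' (φ p) :=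
  normalConnection cov φ (fun q ↦ normalConnection cov φ ξ q (Y q)) p (X p)
    - normalConnection cov φ (fun q ↦ normalConnection cov φ ξ q (X q)) p (Y p)
    - normalConnection cov φ ξ p (mlieBracket I X Y p)

variable (I) in
/-- `M` is totally real: `J T_p M` is orthogonal to `T_p M`. -/
def IsTotallyReal (J : Π x : N, TangentSpace I' x →L[ℝ] TangentSpace I' x) : Prop :=
  ∀ (p : M) (v w : TangentSpace I p),
    ⟪J (φ p) (mfderiv I I' φ p v), mfderiv I I' φ p w⟫ = 0

variable (I) in
/-- `M` has commutative second fundamental forms: `A_ξ A_η = A_η A_ξ` for all normal fields. -/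
def HasCommutativeSecondFundamentalForms : Prop :=
  ∀ ξ η : Π p : M, TangentSpace I' (φ p), IsNormalField I I' φ ξ → IsNormalField I I' φ η →
    ∀ (p : M) (v : TangentSpace I p),
      shapeOperator cov φ ξ p (shapeOperator cov φ η p v)
        = shapeOperator cov φ η p (shapeOperator cov φ ξ p v)

variable (I) in
/-- The endomorphism `f` of the normal bundle: `f ξ` is the normal component of `J ξ`. -/
def normalF (J : Π x : N, TangentSpace I' x →L[ℝ] TangentSpace I' x) (p : M)
    (ξ : TangentSpace I' (φ p)) : TangentSpace I' (φ p) :=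
  normalPart I I' φ p (J (φ p) ξ)

variable (I) in
/-- The `f`-structure in the normal bundle is parallel: `D_v (f ξ) = f (D_v ξ)` for all normal
fields. -/
def HasParallelNormalFStructure (J : Π x : N, TangentSpace I' x →L[ℝ] TangentSpace I' x) : Prop :=
  ∀ ξ : Π p : M, TangentSpace I' (φ p), IsNormalField I I' φ ξ →
    ∀ (p : M) (v : TangentSpace I p),
      normalConnection cov φ (fun q ↦ normalF I φ J q (ξ q)) p v
        = normalF I φ J p (normalConnection cov φ ξ p v)

variable (I) in
/-- The mean curvature vector is semiparallel: `R^⊥(X, Y) H = 0` for all vector fields on `M`. -/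
def HasSemiparallelMeanCurvature : Prop :=
  ∀ X Y : Π p : M, TangentSpace I p, IsSmoothField X → IsSmoothField Y →
    ∀ p : M, normalCurvature cov φ X Y (meanCurvature I cov φ) p = 0

variable (I) in
/-- `M` is totally geodesic: `σ = 0`. -/
def IsTotallyGeodesic : Prop :=
  ∀ (p : M) (v w : TangentSpace I p), secondFundamentalForm cov φ p v w = 0

end Submanifold

end

/-!
A local `C^∞`-linear operation on the fields along `φ` depends only on the value at the point.
Hence identities between such operations, among them the Ricci equation, need only be checked on
the restrictions `W ∘ φ` of vector fields of the ambient manifold.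

For a totally real submanifold with parallel `f`-structure, comparing `D_v (f ξ)` with `f (D_v ξ)`
for `ξ = J w` at a point gives `σ(v, w) = J A_{Jw} v`. So `H = J h` for a tangent vector `h`. As the
shape operators commute, the Ricci equation reduces `R^⊥` to the normal part of the ambient
curvature, and for `x ⊥ h` semiparallelity reads `0 = ⟪R^⊥(x, h) J h, J x⟫ = μ/4 |x|² |h|²`.
If `μ ≠ 0`, choosing `x ≠ 0`, which is possible since `n > 1`, yields `H = 0`. Symmetry and
commutativity of `v · w = A_{Jw} v` then give `|u · e|² = ⟪u · u, e · e⟫`; summed over an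
orthonormal basis the right-hand side is `n ⟪u · u, h⟫ = 0`, so `σ = 0`.
-/

section Coordinates

variable {E' : Type*} [NormedAddCommGroup E'] [NormedSpace ℝ E']
  {H' : Type*} [TopologicalSpace H'] (I' : ModelWithCorners ℝ E' H')
  {N : Type*} [TopologicalSpace N] [ChartedSpace H' N] [IsManifold I' ∞ N]

lemma eventually_mem_baseSet (x₀ : N) :
    ∀ᶠ x in 𝓝 x₀, x ∈ (trivializationAt E' (TangentSpace I' : N → Type _) x₀).baseSet :=
  (trivializationAt E' (TangentSpace I' : N → Type _) x₀).open_baseSet.mem_nhds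
    (FiberBundle.mem_baseSet_trivializationAt' x₀)

/-- The coordinates of the tangent vectors at `x` in the trivialization of `TN` around `x₀`. The
junk value `0` outside of the domain of the trivialization makes it a linear map for all `x`. -/
noncomputable def tangentCoord (x₀ x : N) : TangentSpace I' x →ₗ[ℝ] E' :=
  (trivializationAt E' (TangentSpace I' : N → Type _) x₀).linearMapAt ℝ x

/-- The inverse of `tangentCoord I' x₀ x` for `x` in the domain of the trivialization around `x₀`,
and `0` elsewhere. -/
noncomputable def tangentCoordSymm (x₀ x : N) : E' →ₗ[ℝ] TangentSpace I' x :=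
  (trivializationAt E' (TangentSpace I' : N → Type _) x₀).symmₗ ℝ x

variable {x₀ x : N}

lemma tangentCoord_apply
    (hx : x ∈ (trivializationAt E' (TangentSpace I' : N → Type _) x₀).baseSet)
    (v : TangentSpace I' x) :
    tangentCoord I' x₀ x v = (trivializationAt E' (TangentSpace I' : N → Type _) x₀ ⟨x, v⟩).2 := by
  rw [tangentCoord, Trivialization.coe_linearMapAt_of_mem _ hx]

lemma tangentCoord_tangentCoordSymm
    (hx : x ∈ (trivializationAt E' (TangentSpace I' : N → Type _) x₀).baseSet) (w : E') :
    tangentCoord I' x₀ x (tangentCoordSymm I' x₀ x w) = w :=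
  Trivialization.linearMapAt_symmₗ _ hx w

lemma tangentCoordSymm_tangentCoord
    (hx : x ∈ (trivializationAt E' (TangentSpace I' : N → Type _) x₀).baseSet)
    (v : TangentSpace I' x) :
    tangentCoordSymm I' x₀ x (tangentCoord I' x₀ x v) = v :=
  Trivialization.symmₗ_linearMapAt _ hx v

lemma extend_eq_tangentCoordSymm
    (hx : x ∈ (trivializationAt E' (TangentSpace I' : N → Type _) x₀).baseSet)
    (u : TangentSpace I' x₀) :
    FiberBundle.extend E' u x = tangentCoordSymm I' x₀ x (tangentCoord I' x₀ x₀ u) := by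
  rw [tangentCoord_apply I' (FiberBundle.mem_baseSet_trivializationAt' x₀), tangentCoordSymm,
    Trivialization.coe_symmₗ _ hx]
  rfl

lemma sum_repr_tangentCoord_smul {ι : Type*} [Fintype ι] (b : Basis ι ℝ E')
    (hx : x ∈ (trivializationAt E' (TangentSpace I' : N → Type _) x₀).baseSet)
    (v : TangentSpace I' x) :
    ∑ i, b.repr (tangentCoord I' x₀ x v) i • tangentCoordSymm I' x₀ x (b i) = v := by
  simp_rw [← map_smul, ← map_sum, b.sum_repr, tangentCoordSymm_tangentCoord I' hx]

end Coordinates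

section Smoothness

variable {E : Type*} [NormedAddCommGroup E] [NormedSpace ℝ E]
  {H : Type*} [TopologicalSpace H] {I : ModelWithCorners ℝ E H}
  {M : Type*} [TopologicalSpace M] [ChartedSpace H M]
  {E' : Type*} [NormedAddCommGroup E'] [NormedSpace ℝ E']
  {H' : Type*} [TopologicalSpace H'] {I' : ModelWithCorners ℝ E' H'}
  {N : Type*} [TopologicalSpace N] [ChartedSpace H' N] [IsManifold I' ∞ N]
  {φ : M → N} {ξ η : Π p : M, TangentSpace I' (φ p)} {p q : M}

lemma contMDiffAt_along_iff (hφ : ContMDiff I I' ∞ φ)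
    (hq : φ q ∈ (trivializationAt E' (TangentSpace I' : N → Type _) (φ p)).baseSet) :
    ContMDiffAt I I'.tangent ∞ (fun q ↦ (⟨φ q, ξ q⟩ : TangentBundle I' N)) q ↔
      ContMDiffAt I 𝓘(ℝ, E') ∞ (fun q ↦ tangentCoord I' (φ p) (φ q) (ξ q)) q := by
  set e := trivializationAt E' (TangentSpace I' : N → Type _) (φ p)
  have hcoord : (fun q ↦ tangentCoord I' (φ p) (φ q) (ξ q)) =ᶠ[𝓝 q] fun q ↦ (e ⟨φ q, ξ q⟩).2 := by
    filter_upwards [hφ.continuous.continuousAt.eventually (e.open_baseSet.mem_nhds hq)] with y hy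
      using tangentCoord_apply I' hy _
  rw [hcoord.contMDiffAt_iff, ModelWithCorners.tangent,
    e.contMDiffAt_iff (f := fun q ↦ (⟨φ q, ξ q⟩ : TangentBundle I' N)) (e.mem_source.2 hq)]
  exact and_iff_right (hφ q)

lemma isSmoothAlong_iff (hφ : ContMDiff I I' ∞ φ) :
    IsSmoothAlong I I' φ ξ ↔
      ∀ p, ContMDiffAt I 𝓘(ℝ, E') ∞ (fun q ↦ tangentCoord I' (φ p) (φ q) (ξ q)) p :=
  forall_congr' fun p ↦
    contMDiffAt_along_iff hφ (FiberBundle.mem_baseSet_trivializationAt' (φ p))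

lemma isSmoothAlong_of_eventuallyEq
    (h : ∀ p, ∃ ζ, IsSmoothAlong I I' φ ζ ∧ ∀ᶠ q in 𝓝 p, ξ q = ζ q) : IsSmoothAlong I I' φ ξ := by
  intro p
  obtain ⟨ζ, hζ, h⟩ := h p
  refine (hζ p).congr_of_eventuallyEq ?_
  filter_upwards [h] with q hq
  rw [hq]

namespace IsSmoothField

variable {W : Π x : N, TangentSpace I' x}

lemma mdifferentiableAt (hW : IsSmoothField W) (x : N) :
    MDifferentiableAt I' I'.tangent (fun y ↦ (⟨y, W y⟩ : TangentBundle I' N)) x :=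
  (hW x).mdifferentiableAt (by simp)

lemma comp (hW : IsSmoothField W) (hφ : ContMDiff I I' ∞ φ) :
    IsSmoothAlong I I' φ (fun q ↦ W (φ q)) :=
  ContMDiff.comp (g := fun x ↦ (⟨x, W x⟩ : TangentBundle I' N)) hW hφ

lemma mfderiv [IsManifold I ∞ M] {X : Π p : M, TangentSpace I p} (hφ : ContMDiff I I' ∞ φ)
    (hX : IsSmoothField X) : IsSmoothAlong I I' φ (fun q ↦ mfderiv I I' φ q (X q)) :=
  (hφ.contMDiff_tangentMap (m := ∞) (by simp)).comp hX

lemma contMDiff_mvfderiv [IsManifold I ∞ M] {F : Type*} [NormedAddCommGroup F] [NormedSpace ℝ F]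
    {f : M → F} {X : Π p : M, TangentSpace I p} (hX : IsSmoothField X)
    (hf : ContMDiff I 𝓘(ℝ, F) ∞ f) :
    ContMDiff I 𝓘(ℝ, F) ∞ (fun q ↦ mvfderiv I f q (X q)) :=
  (contMDiff_snd_tangentBundle_modelSpace F 𝓘(ℝ, F)).comp (hX.mfderiv hf)

end IsSmoothField

namespace IsSmoothAlong

lemma base (hξ : IsSmoothAlong I I' φ ξ) : ContMDiff I I' ∞ φ :=
  fun p ↦ (contMDiffAt_totalSpace.1 (hξ p)).1

lemma mdifferentiableAt_coord (hξ : IsSmoothAlong I I' φ ξ) (p : M) :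
    MDifferentiableAt I 𝓘(ℝ, E') (fun q ↦ tangentCoord I' (φ p) (φ q) (ξ q)) p :=
  ((isSmoothAlong_iff hξ.base).1 hξ p).mdifferentiableAt (by simp)

lemma add (hξ : IsSmoothAlong I I' φ ξ) (hη : IsSmoothAlong I I' φ η) :
    IsSmoothAlong I I' φ (fun q ↦ ξ q + η q) := by
  rw [isSmoothAlong_iff hξ.base] at *
  simp only [map_add]
  exact fun p ↦ (hξ p).add (hη p)

lemma smul {f : M → ℝ} (hf : ContMDiff I 𝓘(ℝ, ℝ) ∞ f) (hξ : IsSmoothAlong I I' φ ξ) :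
    IsSmoothAlong I I' φ (fun q ↦ f q • ξ q) := by
  rw [isSmoothAlong_iff hξ.base] at *
  simp only [map_smul]
  exact fun p ↦ (hf p).smul (hξ p)

lemma const_smul (c : ℝ) (hξ : IsSmoothAlong I I' φ ξ) : IsSmoothAlong I I' φ (fun q ↦ c • ξ q) :=
  smul contMDiff_const hξ

lemma neg (hξ : IsSmoothAlong I I' φ ξ) : IsSmoothAlong I I' φ (fun q ↦ -ξ q) := by
  simpa using hξ.const_smul (-1)

lemma sub (hξ : IsSmoothAlong I I' φ ξ) (hη : IsSmoothAlong I I' φ η) :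
    IsSmoothAlong I I' φ (fun q ↦ ξ q - η q) := by
  simpa [sub_eq_add_neg] using hξ.add hη.neg

lemma zero (hφ : ContMDiff I I' ∞ φ) : IsSmoothAlong I I' φ (fun _ ↦ 0) :=
  (contMDiff_zeroSection ℝ (TangentSpace I' : N → Type _)).comp hφ

lemma sum {ι : Type*} (s : Finset ι) {ζ : ι → Π p : M, TangentSpace I' (φ p)}
    (hφ : ContMDiff I I' ∞ φ) (hζ : ∀ i ∈ s, IsSmoothAlong I I' φ (ζ i)) :
    IsSmoothAlong I I' φ (fun q ↦ ∑ i ∈ s, ζ i q) := by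
  rw [isSmoothAlong_iff hφ]
  simpa only [map_sum] using fun p ↦
    ContMDiffAt.sum fun i hi ↦ (isSmoothAlong_iff hφ).1 (hζ i hi) p

end IsSmoothAlong

end Smoothness

section Cutoff

variable {E : Type*} [NormedAddCommGroup E] [NormedSpace ℝ E] [FiniteDimensional ℝ E]
  {H : Type*} [TopologicalSpace H] {I : ModelWithCorners ℝ E H}
  {M : Type*} [TopologicalSpace M] [ChartedSpace H M] [IsManifold I ∞ M] [T2Space M]
  {E' : Type*} [NormedAddCommGroup E'] [NormedSpace ℝ E']
  {H' : Type*} [TopologicalSpace H'] {I' : ModelWithCorners ℝ E' H'}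
  {N : Type*} [TopologicalSpace N] [ChartedSpace H' N] [IsManifold I' ∞ N]
  {φ : M → N} {ξ : Π p : M, TangentSpace I' (φ p)} {p : M}

lemma exists_contMDiff_tsupport_subset_eventuallyEq_one {U : Set M} (hU : U ∈ 𝓝 p) :
    ∃ χ : M → ℝ, ContMDiff I 𝓘(ℝ, ℝ) ∞ χ ∧ tsupport χ ⊆ U ∧ ∀ᶠ q in 𝓝 p, χ q = 1 := by
  obtain ⟨f, hf, -⟩ :=
    (SmoothBumpFunction.nhds_basis_support (I := I) hU).mem_iff.1 Filter.univ_mem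
  exact ⟨f, f.contMDiff, hf, f.eventuallyEq_one⟩

lemma exists_contMDiff_eventuallyEq {F : Type*} [NormedAddCommGroup F] [NormedSpace ℝ F]
    {f : M → F} (hf : ∀ᶠ q in 𝓝 p, ContMDiffAt I 𝓘(ℝ, F) ∞ f q) :
    ∃ g : M → F, ContMDiff I 𝓘(ℝ, F) ∞ g ∧ ∀ᶠ q in 𝓝 p, g q = f q := by
  obtain ⟨χ, hχ, hsupp, hχ1⟩ := exists_contMDiff_tsupport_subset_eventuallyEq_one (I := I) hf
  refine ⟨fun q ↦ χ q • f q, contMDiff_of_tsupport fun q hq ↦ ?_, ?_⟩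
  · exact (hχ q).smul (hsupp (tsupport_smul_subset_left χ f hq))
  · filter_upwards [hχ1] with q hq
    rw [hq, one_smul]

lemma exists_isSmoothAlong_eventuallyEq (hφ : ContMDiff I I' ∞ φ)
    (hξ : ∀ᶠ q in 𝓝 p,
      ContMDiffAt I I'.tangent ∞ (fun q ↦ (⟨φ q, ξ q⟩ : TangentBundle I' N)) q) :
    ∃ ζ, IsSmoothAlong I I' φ ζ ∧ ∀ᶠ q in 𝓝 p, ζ q = ξ q := by
  obtain ⟨χ, hχ, hsupp, hχ1⟩ := exists_contMDiff_tsupport_subset_eventuallyEq_one (I := I) hξ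
  refine ⟨fun q ↦ χ q • ξ q, ?_, by filter_upwards [hχ1] with q hq; rw [hq, one_smul]⟩
  rw [isSmoothAlong_iff hφ]
  intro q
  simp only [map_smul]
  by_cases hq : q ∈ tsupport χ
  · exact (hχ q).smul ((contMDiffAt_along_iff hφ
      (FiberBundle.mem_baseSet_trivializationAt' (φ q))).1 (hsupp hq))
  · refine (contMDiffAt_const (c := (0 : E'))).congr_of_eventuallyEq ?_
    filter_upwards [(isClosed_tsupport χ).isOpen_compl.mem_nhds hq] with y hy
    rw [image_eq_zero_of_notMem_tsupport hy, zero_smul]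

variable (I)

lemma exists_isSmoothField_eventuallyEq_extend (p : M) (v : TangentSpace I p) :
    ∃ X : Π q : M, TangentSpace I q, IsSmoothField X ∧
      ∀ᶠ q in 𝓝 p, X q = FiberBundle.extend E v q := by
  refine exists_isSmoothAlong_eventuallyEq (φ := (id : M → M)) contMDiff_id ?_
  obtain ⟨s, hs, h⟩ := FiberBundle.exists_contMDiffOn_extend (k := ∞) I E v
  filter_upwards [eventually_mem_nhds_iff.2 hs] with q hq
  exact h.contMDiffAt hq

lemma exists_isSmoothField_apply_eq (p : M) (v : TangentSpace I p) :
    ∃ X : Π q : M, TangentSpace I q, IsSmoothField X ∧ X p = v := by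
  obtain ⟨X, hX, h⟩ := exists_isSmoothField_eventuallyEq_extend I p v
  exact ⟨X, hX, by simpa using h.self_of_nhds⟩

lemma exists_isSmoothField_eventuallyEq_tangentCoordSymm (p : M) (w : E) :
    ∃ X : Π q : M, TangentSpace I q, IsSmoothField X ∧
      ∀ᶠ q in 𝓝 p, X q = tangentCoordSymm I p q w := by
  obtain ⟨X, hX, h⟩ := exists_isSmoothField_eventuallyEq_extend I p (tangentCoordSymm I p p w)
  refine ⟨X, hX, ?_⟩
  filter_upwards [h, eventually_mem_baseSet I p] with q hq hmem
  rw [hq, extend_eq_tangentCoordSymm I hmem,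
    tangentCoord_tangentCoordSymm I (FiberBundle.mem_baseSet_trivializationAt' p)]

end Cutoff

section Tensoriality

variable {E : Type*} [NormedAddCommGroup E] [NormedSpace ℝ E]
  {H : Type*} [TopologicalSpace H] {I : ModelWithCorners ℝ E H}
  {M : Type*} [TopologicalSpace M] [ChartedSpace H M]
  {E' : Type*} [NormedAddCommGroup E'] [NormedSpace ℝ E']
  {H' : Type*} [TopologicalSpace H'] {I' : ModelWithCorners ℝ E' H'}
  {N : Type*} [TopologicalSpace N] [ChartedSpace H' N] [IsManifold I' ∞ N]
  {φ : M → N} {p : M}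

variable (I I') in
/-- `Φ` is an operation on the smooth fields along `φ` which is local at `p` and linear over the
smooth functions; by `IsTensorialAlong.exists_linearMap` it only depends on the value of the field
at `p`. -/
structure IsTensorialAlong (φ : M → N) (p : M) {A : Type*} [AddCommGroup A] [Module ℝ A]
    (Φ : (Π q : M, TangentSpace I' (φ q)) → A) : Prop where
  congr : ∀ ξ η, IsSmoothAlong I I' φ ξ → IsSmoothAlong I I' φ η →
    (∀ᶠ q in 𝓝 p, ξ q = η q) → Φ ξ = Φ η
  add : ∀ ξ η, IsSmoothAlong I I' φ ξ → IsSmoothAlong I I' φ η →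
    Φ (fun q ↦ ξ q + η q) = Φ ξ + Φ η
  smul : ∀ (f : M → ℝ) (ξ), ContMDiff I 𝓘(ℝ, ℝ) ∞ f → IsSmoothAlong I I' φ ξ →
    Φ (fun q ↦ f q • ξ q) = f p • Φ ξ

variable {A : Type*} [AddCommGroup A] [Module ℝ A] {Φ : (Π q : M, TangentSpace I' (φ q)) → A}

lemma IsTensorialAlong.map_sum_smul (hΦ : IsTensorialAlong I I' φ p Φ) (hφ : ContMDiff I I' ∞ φ)
    {ι : Type*} (s : Finset ι) {f : ι → M → ℝ} {ζ : ι → Π q : M, TangentSpace I' (φ q)}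
    (hf : ∀ i, ContMDiff I 𝓘(ℝ, ℝ) ∞ (f i)) (hζ : ∀ i, IsSmoothAlong I I' φ (ζ i)) :
    Φ (fun q ↦ ∑ i ∈ s, f i q • ζ i q) = ∑ i ∈ s, f i p • Φ (ζ i) := by
  classical
  induction s using Finset.induction_on with
  | empty => simpa using hΦ.smul (fun _ ↦ 0) _ contMDiff_const (.zero hφ)
  | insert a s ha ih =>
    simp only [Finset.sum_insert ha]
    rw [hΦ.add _ _ (.smul (hf a) (hζ a)) (.sum s hφ fun i _ ↦ .smul (hf i) (hζ i)),
      hΦ.smul _ _ (hf a) (hζ a), ih]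

variable [FiniteDimensional ℝ E] [IsManifold I ∞ M] [T2Space M]
  [FiniteDimensional ℝ E'] [T2Space N]

lemma exists_frame_along (hφ : ContMDiff I I' ∞ φ) (p : M) :
    ∃ (W : Fin (finrank ℝ E') → Π x : N, TangentSpace I' x)
      (c : Fin (finrank ℝ E') → TangentSpace I' (φ p) →ₗ[ℝ] ℝ),
      (∀ i, IsSmoothField (W i)) ∧ ∀ ξ, IsSmoothAlong I I' φ ξ →
        ∃ f : Fin (finrank ℝ E') → M → ℝ, (∀ i, ContMDiff I 𝓘(ℝ, ℝ) ∞ (f i)) ∧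
          (∀ i, f i p = c i (ξ p)) ∧ ∀ᶠ q in 𝓝 p, ξ q = ∑ i, f i q • W i (φ q) := by
  let b := finBasis ℝ E'
  choose W hW hWb using fun i ↦
    exists_isSmoothField_eventuallyEq_tangentCoordSymm I' (φ p) (b i)
  refine ⟨W, fun i ↦ b.coord i ∘ₗ tangentCoord I' (φ p) (φ p), hW, fun ξ hξ ↦ ?_⟩
  have hmem : ∀ᶠ q in 𝓝 p,
      φ q ∈ (trivializationAt E' (TangentSpace I' : N → Type _) (φ p)).baseSet :=
    hφ.continuous.continuousAt.eventually (eventually_mem_baseSet I' (φ p))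
  have hcomp (i) : ∃ f : M → ℝ, ContMDiff I 𝓘(ℝ, ℝ) ∞ f ∧
      ∀ᶠ q in 𝓝 p, f q = b.coord i (tangentCoord I' (φ p) (φ q) (ξ q)) := by
    refine exists_contMDiff_eventuallyEq ?_
    filter_upwards [hmem] with q hq
    exact (b.coord i).toContinuousLinearMap.contMDiff.contMDiffAt.comp q
      ((contMDiffAt_along_iff hφ hq).1 (hξ q))
  choose f hf hfξ using hcomp
  refine ⟨f, hf, fun i ↦ (hfξ i).self_of_nhds, ?_⟩
  filter_upwards [hmem, Filter.eventually_all.2 hfξ,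
    hφ.continuous.continuousAt.eventually (Filter.eventually_all.2 hWb)] with q hq hfq hWq
  simp only [hfq, hWq]
  exact (sum_repr_tangentCoord_smul I' b hq (ξ q)).symm

namespace IsTensorialAlong

theorem exists_linearMap (hΦ : IsTensorialAlong I I' φ p Φ) (hφ : ContMDiff I I' ∞ φ) :
    ∃ L : TangentSpace I' (φ p) →ₗ[ℝ] A, ∀ ξ, IsSmoothAlong I I' φ ξ → Φ ξ = L (ξ p) := by
  obtain ⟨W, c, hW, hframe⟩ := exists_frame_along hφ p
  refine ⟨∑ i, (c i).smulRight (Φ fun q ↦ W i (φ q)), fun ξ hξ ↦ ?_⟩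
  obtain ⟨f, hf, hfc, hξW⟩ := hframe ξ hξ
  rw [hΦ.congr _ _ hξ (.sum _ hφ fun i _ ↦ .smul (hf i) ((hW i).comp hφ)) hξW,
    hΦ.map_sum_smul hφ _ hf fun i ↦ (hW i).comp hφ]
  simp [LinearMap.sum_apply, hfc]

theorem congr_apply (hΦ : IsTensorialAlong I I' φ p Φ) {ξ η : Π q : M, TangentSpace I' (φ q)}
    (hξ : IsSmoothAlong I I' φ ξ) (hη : IsSmoothAlong I I' φ η) (h : ξ p = η p) : Φ ξ = Φ η := by
  obtain ⟨L, hL⟩ := hΦ.exists_linearMap hξ.base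
  rw [hL ξ hξ, hL η hη, h]

theorem exists_comp_eq (hΦ : IsTensorialAlong I I' φ p Φ) {ξ : Π q : M, TangentSpace I' (φ q)}
    (hξ : IsSmoothAlong I I' φ ξ) :
    ∃ W : Π x : N, TangentSpace I' x, IsSmoothField W ∧ W (φ p) = ξ p ∧
      Φ ξ = Φ fun q ↦ W (φ q) := by
  obtain ⟨W, hW, h⟩ := exists_isSmoothField_apply_eq I' (φ p) (ξ p)
  exact ⟨W, hW, h, hΦ.congr_apply hξ (hW.comp hξ.base) h.symm⟩

end IsTensorialAlong

end Tensoriality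

section MvfDeriv

variable {E : Type*} [NormedAddCommGroup E] [NormedSpace ℝ E]
  {H : Type*} [TopologicalSpace H] {I : ModelWithCorners ℝ E H}
  {M : Type*} [TopologicalSpace M] [ChartedSpace H M]
  {E' : Type*} [NormedAddCommGroup E'] [NormedSpace ℝ E']
  {H' : Type*} [TopologicalSpace H'] {I' : ModelWithCorners ℝ E' H'}
  {N : Type*} [TopologicalSpace N] [ChartedSpace H' N]
  {F : Type*} [NormedAddCommGroup F] [NormedSpace ℝ F] {p : M}

lemma mvfderiv_congr {f g : M → F} (h : f =ᶠ[𝓝 p] g) (v : TangentSpace I p) :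
    mvfderiv I f p v = mvfderiv I g p v := by
  have hd : (mfderiv I 𝓘(ℝ, F) f p v : F) = mfderiv I 𝓘(ℝ, F) g p v := by rw [h.mfderiv_eq]; rfl
  exact hd

lemma mvfderiv_comp_mfderiv {φ : M → N} {g : N → F} (hg : MDifferentiableAt I' 𝓘(ℝ, F) g (φ p))
    (hφ : MDifferentiableAt I I' φ p) (v : TangentSpace I p) :
    mvfderiv I (fun q ↦ g (φ q)) p v = mvfderiv I' g (φ p) (mfderiv I I' φ p v) :=
  mfderiv_comp_apply p hg hφ v

lemma mvfderiv_clm_comp {G : Type*} [NormedAddCommGroup G] [NormedSpace ℝ G] (ℓ : F →L[ℝ] G)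
    {f : M → F} (hf : MDifferentiableAt I 𝓘(ℝ, F) f p) (v : TangentSpace I p) :
    mvfderiv I (fun q ↦ ℓ (f q)) p v = ℓ (mvfderiv I f p v) := by
  rw [mvfderiv_comp_mfderiv ℓ.mdifferentiableAt hf]
  exact congr($(ℓ.mfderiv_eq) _)

end MvfDeriv

section ConnectionForm

variable {E' : Type*} [NormedAddCommGroup E'] [NormedSpace ℝ E']
  {H' : Type*} [TopologicalSpace H'] {I' : ModelWithCorners ℝ E' H'}
  {N : Type*} [TopologicalSpace N] [ChartedSpace H' N] [IsManifold I' ∞ N] {x : N}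

lemma mdifferentiableAt_tangentCoord {W : Π y : N, TangentSpace I' y}
    (hW : MDifferentiableAt I' I'.tangent (fun y ↦ (⟨y, W y⟩ : TangentBundle I' N)) x) :
    MDifferentiableAt I' 𝓘(ℝ, E') (fun y ↦ tangentCoord I' x y (W y)) x := by
  refine ((mdifferentiableAt_totalSpace I' _).1 hW).2.congr_of_eventuallyEq ?_
  filter_upwards [eventually_mem_baseSet I' x] with y hy using tangentCoord_apply I' hy _

variable (cov : CovariantDerivative I' E' (fun x : N ↦ TangentSpace I' x))

lemma tensorialAt_cov_sub_mvfderiv_tangentCoord (v : TangentSpace I' x) :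
    TensorialAt I' E' (fun W ↦ cov W x v - tangentCoordSymm I' x x
      (mvfderiv I' (fun y ↦ tangentCoord I' x y (W y)) x v)) x where
  add {V W} hV hW := by
    have hcoord : (fun y ↦ tangentCoord I' x y ((V + W) y))
        = (fun y ↦ tangentCoord I' x y (V y)) + fun y ↦ tangentCoord I' x y (W y) :=
      funext fun y ↦ map_add _ _ _
    rw [hcoord, mvfderiv_add (mdifferentiableAt_tangentCoord hV)
      (mdifferentiableAt_tangentCoord hW), cov.isCovariantDerivativeOnUniv.add hV hW]
    simp only [add_apply, map_add]
    module
  smul {f W} hf hW := by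
    have hcoord : (fun y ↦ tangentCoord I' x y ((f • W) y))
        = f • fun y ↦ tangentCoord I' x y (W y) :=
      funext fun y ↦ map_smul _ _ _
    rw [hcoord, mvfderiv_smul hf (mdifferentiableAt_tangentCoord hW),
      cov.isCovariantDerivativeOnUniv.leibniz hW hf]
    simp only [add_apply, smul_apply, ContinuousLinearMap.smulRight_apply, map_add, map_smul,
      tangentCoordSymm_tangentCoord I' (FiberBundle.mem_baseSet_trivializationAt' x)]
    module

variable [FiniteDimensional ℝ E'] {W : Π y : N, TangentSpace I' y}

/-- The connection form of `cov` at `x` in the trivialization of `TN` around `x`: the difference of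
the covariant derivative and of the derivative of the coordinates. -/
noncomputable def connectionForm (x : N) (v : TangentSpace I' x) :
    TangentSpace I' x →L[ℝ] TangentSpace I' x :=
  TensorialAt.mkHom _ x (tensorialAt_cov_sub_mvfderiv_tangentCoord cov v)

lemma cov_eq_mvfderiv_add_connectionForm
    (hW : MDifferentiableAt I' I'.tangent (fun y ↦ (⟨y, W y⟩ : TangentBundle I' N)) x)
    (v : TangentSpace I' x) :
    cov W x v = tangentCoordSymm I' x x (mvfderiv I' (fun y ↦ tangentCoord I' x y (W y)) x v)
      + connectionForm cov x v (W x) := by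
  rw [connectionForm, TensorialAt.mkHom_apply _ hW, add_sub_cancel]

lemma cov_extend (v u : TangentSpace I' x) :
    cov (FiberBundle.extend E' u) x v = connectionForm cov x v u := by
  have hconst : (fun y ↦ tangentCoord I' x y (FiberBundle.extend E' u y))
      =ᶠ[𝓝 x] fun _ ↦ tangentCoord I' x x u := by
    filter_upwards [eventually_mem_baseSet I' x] with y hy
    rw [extend_eq_tangentCoordSymm I' hy, tangentCoord_tangentCoordSymm I' hy]
  rw [connectionForm, TensorialAt.mkHom_apply_eq_extend, mvfderiv_congr hconst, mvfderiv_const,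
    zero_apply, map_zero, sub_zero]

end ConnectionForm

section CovAlong

variable {E : Type*} [NormedAddCommGroup E] [NormedSpace ℝ E]
  {H : Type*} [TopologicalSpace H] {I : ModelWithCorners ℝ E H}
  {M : Type*} [TopologicalSpace M] [ChartedSpace H M]
  {E' : Type*} [NormedAddCommGroup E'] [NormedSpace ℝ E']
  {H' : Type*} [TopologicalSpace H'] {I' : ModelWithCorners ℝ E' H'}
  {N : Type*} [TopologicalSpace N] [ChartedSpace H' N] [IsManifold I' ∞ N]
  {φ : M → N} {ξ η : Π p : M, TangentSpace I' (φ p)} {p : M}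
  (cov : CovariantDerivative I' E' (fun x : N ↦ TangentSpace I' x))

lemma covAlong_congr (h : ∀ᶠ q in 𝓝 p, ξ q = η q) (v : TangentSpace I p) :
    covAlong I cov φ ξ p v = covAlong I cov φ η p v := by
  have hcoord : (fun q ↦ (trivializationAt E' (TangentSpace I' : N → Type _) (φ p) ⟨φ q, ξ q⟩).2)
      =ᶠ[𝓝 p] fun q ↦ (trivializationAt E' (TangentSpace I' : N → Type _) (φ p) ⟨φ q, η q⟩).2 := by
    filter_upwards [h] with q hq
    rw [hq]
  rw [covAlong, covAlong, mvfderiv_congr hcoord, h.self_of_nhds]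

variable [FiniteDimensional ℝ E']

lemma covAlong_eq (hφ : ContinuousAt φ p) (v : TangentSpace I p) :
    covAlong I cov φ ξ p v = tangentCoordSymm I' (φ p) (φ p)
        (mvfderiv I (fun q ↦ tangentCoord I' (φ p) (φ q) (ξ q)) p v)
      + connectionForm cov (φ p) (mfderiv I I' φ p v) (ξ p) := by
  have hcoord : (fun q ↦ tangentCoord I' (φ p) (φ q) (ξ q)) =ᶠ[𝓝 p]
      fun q ↦ (trivializationAt E' (TangentSpace I' : N → Type _) (φ p) ⟨φ q, ξ q⟩).2 := by
    filter_upwards [hφ.eventually (eventually_mem_baseSet I' (φ p))] with q hq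
      using tangentCoord_apply I' hq _
  rw [covAlong, cov_extend, mvfderiv_congr hcoord, tangentCoordSymm,
    Trivialization.coe_symmₗ _ (FiberBundle.mem_baseSet_trivializationAt' (φ p))]

lemma covAlong_add (hξ : IsSmoothAlong I I' φ ξ) (hη : IsSmoothAlong I I' φ η)
    (v : TangentSpace I p) :
    covAlong I cov φ (fun q ↦ ξ q + η q) p v
      = covAlong I cov φ ξ p v + covAlong I cov φ η p v := by
  have hcoord : (fun q ↦ tangentCoord I' (φ p) (φ q) (ξ q + η q))
      = (fun q ↦ tangentCoord I' (φ p) (φ q) (ξ q))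
        + fun q ↦ tangentCoord I' (φ p) (φ q) (η q) :=
    funext fun q ↦ map_add _ _ _
  have hc := hξ.base.continuous.continuousAt (x := p)
  rw [covAlong_eq cov hc, covAlong_eq cov hc, covAlong_eq cov hc, hcoord,
    mvfderiv_add (hξ.mdifferentiableAt_coord p) (hη.mdifferentiableAt_coord p)]
  simp only [add_apply, map_add]
  module

lemma covAlong_smul {f : M → ℝ} (hf : ContMDiff I 𝓘(ℝ, ℝ) ∞ f) (hξ : IsSmoothAlong I I' φ ξ)
    (v : TangentSpace I p) :
    covAlong I cov φ (fun q ↦ f q • ξ q) p v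
      = mvfderiv I f p v • ξ p + f p • covAlong I cov φ ξ p v := by
  have hcoord : (fun q ↦ tangentCoord I' (φ p) (φ q) (f q • ξ q))
      = f • fun q ↦ tangentCoord I' (φ p) (φ q) (ξ q) :=
    funext fun q ↦ map_smul _ _ _
  have hc := hξ.base.continuous.continuousAt (x := p)
  rw [covAlong_eq cov hc, covAlong_eq cov hc, hcoord,
    mvfderiv_smul ((hf p).mdifferentiableAt (by simp)) (hξ.mdifferentiableAt_coord p)]
  simp only [add_apply, smul_apply, ContinuousLinearMap.smulRight_apply, map_add, map_smul,
    tangentCoordSymm_tangentCoord I' (FiberBundle.mem_baseSet_trivializationAt' (φ p))]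
  module

lemma covAlong_const_smul (c : ℝ) (hξ : IsSmoothAlong I I' φ ξ) (v : TangentSpace I p) :
    covAlong I cov φ (fun q ↦ c • ξ q) p v = c • covAlong I cov φ ξ p v := by
  rw [covAlong_smul cov contMDiff_const hξ, mvfderiv_const, zero_apply, zero_smul, zero_add]

lemma covAlong_neg (hξ : IsSmoothAlong I I' φ ξ) (v : TangentSpace I p) :
    covAlong I cov φ (fun q ↦ -ξ q) p v = -covAlong I cov φ ξ p v := by
  simpa using covAlong_const_smul cov (-1) hξ v

lemma covAlong_sub (hξ : IsSmoothAlong I I' φ ξ) (hη : IsSmoothAlong I I' φ η)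
    (v : TangentSpace I p) :
    covAlong I cov φ (fun q ↦ ξ q - η q) p v
      = covAlong I cov φ ξ p v - covAlong I cov φ η p v := by
  simpa only [sub_eq_add_neg, covAlong_neg cov hη] using covAlong_add cov hξ hη.neg v

lemma covAlong_comp {W : Π x : N, TangentSpace I' x} (hφ : MDifferentiableAt I I' φ p)
    (hW : IsSmoothField W) (v : TangentSpace I p) :
    covAlong I cov φ (fun q ↦ W (φ q)) p v = cov W (φ p) (mfderiv I I' φ p v) := by
  rw [cov_eq_mvfderiv_add_connectionForm cov (hW.mdifferentiableAt _),
    covAlong_eq cov hφ.continuousAt,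
    mvfderiv_comp_mfderiv (mdifferentiableAt_tangentCoord (hW.mdifferentiableAt _)) hφ]

end CovAlong

section Bracket

variable {E : Type*} [NormedAddCommGroup E] [NormedSpace ℝ E] [FiniteDimensional ℝ E]
  {H : Type*} [TopologicalSpace H] {I : ModelWithCorners ℝ E H}
  {M : Type*} [TopologicalSpace M] [ChartedSpace H M] [IsManifold I ∞ M]
  {E' : Type*} [NormedAddCommGroup E'] [NormedSpace ℝ E']
  {H' : Type*} [TopologicalSpace H'] {I' : ModelWithCorners ℝ E' H'}
  {N : Type*} [TopologicalSpace N] [ChartedSpace H' N] [IsManifold I' ∞ N]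
  {φ : M → N} {X Y W : Π p : M, TangentSpace I p} {f : M → ℝ} {p : M}

lemma IsSmoothField.mlieBracket (hX : IsSmoothField X) (hY : IsSmoothField Y) :
    IsSmoothField (mlieBracket I X Y) := by
  have : IsManifold I (∞ + 1) M := inferInstanceAs (IsManifold I ∞ M)
  have : IsManifold I (minSmoothness ℝ 2) M := by
    rw [minSmoothness_of_isRCLikeNormedField]
    infer_instance
  exact fun p ↦ ContMDiffAt.mlieBracket_vectorField (hX p) (hY p)
    (by rw [minSmoothness_of_isRCLikeNormedField]; rfl)

lemma mlieBracket_mlieBracket_smul (hf : ContMDiff I 𝓘(ℝ, ℝ) ∞ f) (hY : IsSmoothField Y)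
    (hW : IsSmoothField W) :
    mlieBracket I X (mlieBracket I Y (f • W)) p
      = mvfderiv I (fun q ↦ mvfderiv I f q (Y q)) p (X p) • W p
        + mvfderiv I f p (Y p) • mlieBracket I X W p
        + (mvfderiv I f p (X p) • mlieBracket I Y W p
          + f p • mlieBracket I X (mlieBracket I Y W) p) := by
  have hfd (q : M) : MDifferentiableAt I 𝓘(ℝ, ℝ) f q := (hf q).mdifferentiableAt (by simp)
  have hYfd : MDifferentiableAt I 𝓘(ℝ, ℝ) (fun q ↦ mvfderiv I f q (Y q)) p :=
    (hY.contMDiff_mvfderiv hf p).mdifferentiableAt (by simp)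
  have hYfW : mlieBracket I Y (f • W)
      = (fun q ↦ mvfderiv I f q (Y q)) • W + f • mlieBracket I Y W :=
    funext fun q ↦ mlieBracket_smul_right (hfd q) (hW.mdifferentiableAt q)
  have hYW := (hY.mlieBracket hW).mdifferentiableAt p
  rw [hYfW, mlieBracket_add_right (hYfd.smul_section (hW.mdifferentiableAt p))
      ((hfd p).smul_section hYW), mlieBracket_smul_right hYfd (hW.mdifferentiableAt p),
    mlieBracket_smul_right (hfd p) hYW]

lemma jacobi_mlieBracket (hX : IsSmoothField X) (hY : IsSmoothField Y) (hW : IsSmoothField W) :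
    mlieBracket I X (mlieBracket I Y W) p = mlieBracket I (mlieBracket I X Y) W p
      + mlieBracket I Y (mlieBracket I X W) p := by
  have : IsManifold I (minSmoothness ℝ 3) M := by
    rw [minSmoothness_of_isRCLikeNormedField]
    infer_instance
  have h2 : minSmoothness ℝ 2 ≤ (∞ : WithTop ℕ∞) := by
    rw [minSmoothness_of_isRCLikeNormedField]
    exact ENat.LEInfty.out
  exact leibniz_identity_mlieBracket_apply ((hX p).of_le h2) ((hY p).of_le h2) ((hW p).of_le h2)

/- Compare the coefficients of `W` in the Jacobi identity for `X`, `Y` and `f • W`. -/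
lemma mvfderiv_mlieBracket_smul (hf : ContMDiff I 𝓘(ℝ, ℝ) ∞ f) (hX : IsSmoothField X)
    (hY : IsSmoothField Y) (hW : IsSmoothField W) :
    mvfderiv I f p (mlieBracket I X Y p) • W p
      = (mvfderiv I (fun q ↦ mvfderiv I f q (Y q)) p (X p)
        - mvfderiv I (fun q ↦ mvfderiv I f q (X q)) p (Y p)) • W p := by
  have hfW : IsSmoothField (f • W) := IsSmoothAlong.smul (φ := id) hf hW
  have hJ := jacobi_mlieBracket (p := p) hX hY hfW
  rw [mlieBracket_mlieBracket_smul hf hY hW, mlieBracket_mlieBracket_smul hf hX hW,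
    mlieBracket_smul_right ((hf p).mdifferentiableAt (by simp)) (hW.mdifferentiableAt p),
    jacobi_mlieBracket hX hY hW, ← sub_eq_zero] at hJ
  rw [← sub_eq_zero, ← neg_eq_zero, ← hJ]
  module

variable [T2Space M]

theorem mvfderiv_mlieBracket_real (hf : ContMDiff I 𝓘(ℝ, ℝ) ∞ f) (hX : IsSmoothField X)
    (hY : IsSmoothField Y) (p : M) :
    mvfderiv I f p (mlieBracket I X Y p)
      = mvfderiv I (fun q ↦ mvfderiv I f q (Y q)) p (X p)
        - mvfderiv I (fun q ↦ mvfderiv I f q (X q)) p (Y p) := by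
  rcases subsingleton_or_nontrivial (TangentSpace I p) with _ | _
  · rw [Subsingleton.elim (mlieBracket I X Y p) 0, Subsingleton.elim (X p) 0,
      Subsingleton.elim (Y p) 0]
    simp
  · obtain ⟨w, hw⟩ := exists_ne (0 : TangentSpace I p)
    obtain ⟨W, hW, rfl⟩ := exists_isSmoothField_apply_eq I p w
    exact smul_left_injective ℝ hw (mvfderiv_mlieBracket_smul hf hX hY hW)

theorem mvfderiv_mlieBracket {F : Type*} [NormedAddCommGroup F] [NormedSpace ℝ F] {f : M → F}
    (hf : ContMDiff I 𝓘(ℝ, F) ∞ f) (hX : IsSmoothField X) (hY : IsSmoothField Y) (p : M) :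
    mvfderiv I f p (mlieBracket I X Y p)
      = mvfderiv I (fun q ↦ mvfderiv I f q (Y q)) p (X p)
        - mvfderiv I (fun q ↦ mvfderiv I f q (X q)) p (Y p) := by
  refine (SeparatingDual.eq_iff_forall_dual_eq (R := ℝ)).2 fun ℓ ↦ ?_
  have hsmooth {Z : Π p : M, TangentSpace I p} (hZ : IsSmoothField Z) :
      MDifferentiableAt I 𝓘(ℝ, F) (fun q ↦ mvfderiv I f q (Z q)) p :=
    (hZ.contMDiff_mvfderiv hf p).mdifferentiableAt (by simp)
  have hℓ (q : M) (v : TangentSpace I q) :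
      mvfderiv I (fun q ↦ ℓ (f q)) q v = ℓ (mvfderiv I f q v) :=
    mvfderiv_clm_comp ℓ ((hf q).mdifferentiableAt (by simp)) v
  have hreal := mvfderiv_mlieBracket_real (ℓ.contMDiff.comp hf) hX hY p
  simp only [Function.comp_def, hℓ] at hreal
  rw [hreal, map_sub, mvfderiv_clm_comp ℓ (hsmooth hY), mvfderiv_clm_comp ℓ (hsmooth hX)]

lemma tangentCoord_eq_mvfderiv_extChartAt {x₀ x : N} (hx : x ∈ (chartAt H' x₀).source)
    (v : TangentSpace I' x) :
    tangentCoord I' x₀ x v = mvfderiv I' (extChartAt I' x₀) x v := by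
  have hchart := TangentBundle.continuousLinearMapAt_trivializationAt (I := I') hx
  exact congr($hchart v)

theorem tangentCoord_mfderiv_mlieBracket [FiniteDimensional ℝ E'] [T2Space N]
    (hφ : ContMDiff I I' ∞ φ) (hX : IsSmoothField X) (hY : IsSmoothField Y) (p : M) :
    tangentCoord I' (φ p) (φ p) (mfderiv I I' φ p (mlieBracket I X Y p))
      = mvfderiv I (fun q ↦ tangentCoord I' (φ p) (φ q) (mfderiv I I' φ q (Y q))) p (X p)
        - mvfderiv I (fun q ↦ tangentCoord I' (φ p) (φ q) (mfderiv I I' φ q (X q))) p (Y p) := by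
  have hchart : ∀ᶠ x in 𝓝 (φ p), x ∈ (chartAt H' (φ p)).source :=
    (chartAt H' (φ p)).open_source.mem_nhds (mem_chart_source H' (φ p))
  obtain ⟨g, hg, hgchart⟩ := exists_contMDiff_eventuallyEq (I := I') (p := φ p)
    (f := extChartAt I' (φ p)) (hchart.mono fun x hx ↦ contMDiffAt_extChartAt' hx)
  have hgφ (q : M) (v : TangentSpace I q) :
      mvfderiv I (fun q ↦ g (φ q)) q v = mvfderiv I' g (φ q) (mfderiv I I' φ q v) :=
    mvfderiv_comp_mfderiv ((hg _).mdifferentiableAt (by simp)) ((hφ q).mdifferentiableAt (by simp))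
      v
  have hcoord : ∀ᶠ q in 𝓝 p, ∀ v : TangentSpace I q,
      tangentCoord I' (φ p) (φ q) (mfderiv I I' φ q v) = mvfderiv I (fun q ↦ g (φ q)) q v := by
    filter_upwards [hφ.continuous.continuousAt.eventually (hchart.and hgchart.eventually_nhds)]
      with q hq v
    rw [hgφ, tangentCoord_eq_mvfderiv_extChartAt hq.1, mvfderiv_congr hq.2]
  rw [hcoord.self_of_nhds, mvfderiv_congr (hcoord.mono fun q hq ↦ hq (Y q)),
    mvfderiv_congr (hcoord.mono fun q hq ↦ hq (X q))]
  exact mvfderiv_mlieBracket (hg.comp hφ) hX hY p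

end Bracket

section SmoothCovAlong

variable {E : Type*} [NormedAddCommGroup E] [NormedSpace ℝ E]
  {H : Type*} [TopologicalSpace H] {I : ModelWithCorners ℝ E H}
  {M : Type*} [TopologicalSpace M] [ChartedSpace H M]
  {E' : Type*} [NormedAddCommGroup E'] [NormedSpace ℝ E']
  {H' : Type*} [TopologicalSpace H'] {I' : ModelWithCorners ℝ E' H'}
  {N : Type*} [TopologicalSpace N] [ChartedSpace H' N] [IsManifold I' ∞ N]
  {φ : M → N} {ξ : Π p : M, TangentSpace I' (φ p)} {X : Π p : M, TangentSpace I p} {p : M}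
  {cov : CovariantDerivative I' E' (fun x : N ↦ TangentSpace I' x)}

lemma IsSmoothAlong.clm_apply {J : Π x : N, TangentSpace I' x →L[ℝ] TangentSpace I' x}
    (hJ : ContMDiff I' (I'.prod 𝓘(ℝ, E' →L[ℝ] E')) ∞
      (fun x ↦ (⟨x, J x⟩ : TotalSpace (E' →L[ℝ] E')
        (fun x : N ↦ TangentSpace I' x →L[ℝ] TangentSpace I' x))))
    (hξ : IsSmoothAlong I I' φ ξ) : IsSmoothAlong I I' φ (fun q ↦ J (φ q) (ξ q)) :=
  ContMDiff.clm_bundle_apply (b := φ) (ϕ := fun q ↦ J (φ q)) (hJ.comp hξ.base) hξ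

lemma contMDiff_cov (hcov : CovariantDerivative.ContMDiffCovariantDerivative cov ∞)
    {W : Π x : N, TangentSpace I' x} (hW : IsSmoothField W) :
    ContMDiff I' (I'.prod 𝓘(ℝ, E' →L[ℝ] E')) ∞
      (fun x ↦ (⟨x, cov W x⟩ : TotalSpace (E' →L[ℝ] E')
        (fun x : N ↦ TangentSpace I' x →L[ℝ] TangentSpace I' x))) :=
  contMDiffOn_univ.1 (hcov.contMDiff.contMDiff (contMDiffOn_univ.2 hW))

lemma IsSmoothAlong.cov_apply (hcov : CovariantDerivative.ContMDiffCovariantDerivative cov ∞)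
    {W : Π x : N, TangentSpace I' x} (hW : IsSmoothField W) (hξ : IsSmoothAlong I I' φ ξ) :
    IsSmoothAlong I I' φ (fun q ↦ cov W (φ q) (ξ q)) :=
  hξ.clm_apply (contMDiff_cov hcov hW)

lemma IsSmoothField.cov_apply (hcov : CovariantDerivative.ContMDiffCovariantDerivative cov ∞)
    {V W : Π x : N, TangentSpace I' x} (hW : IsSmoothField W) (hV : IsSmoothField V) :
    IsSmoothField (fun x ↦ cov W x (V x)) :=
  IsSmoothAlong.cov_apply (I := I') (φ := id) hcov hW hV

variable [FiniteDimensional ℝ E']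

lemma covAlong_sum {ι : Type*} (s : Finset ι) {ζ : ι → Π p : M, TangentSpace I' (φ p)}
    (hφ : ContMDiff I I' ∞ φ) (hζ : ∀ i, IsSmoothAlong I I' φ (ζ i)) (v : TangentSpace I p) :
    covAlong I cov φ (fun q ↦ ∑ i ∈ s, ζ i q) p v = ∑ i ∈ s, covAlong I cov φ (ζ i) p v := by
  classical
  induction s using Finset.induction_on with
  | empty => simpa using covAlong_const_smul cov 0 (.zero hφ) v
  | insert a s ha ih =>
    simp only [Finset.sum_insert ha]
    rw [covAlong_add cov (hζ a) (.sum s hφ fun i _ ↦ hζ i), ih]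

variable [FiniteDimensional ℝ E] [IsManifold I ∞ M] [T2Space M] [T2Space N]

theorem IsSmoothAlong.covAlong (hcov : CovariantDerivative.ContMDiffCovariantDerivative cov ∞)
    (hξ : IsSmoothAlong I I' φ ξ) (hX : IsSmoothField X) :
    IsSmoothAlong I I' φ (fun q ↦ covAlong I cov φ ξ q (X q)) := by
  have hφ := hξ.base
  refine isSmoothAlong_of_eventuallyEq fun p ↦ ?_
  obtain ⟨W, _, hW, hframe⟩ := exists_frame_along hφ p
  obtain ⟨f, hf, -, hξW⟩ := hframe ξ hξ
  refine ⟨fun q ↦ ∑ i, (mvfderiv I (f i) q (X q) • W i (φ q)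
    + f i q • cov (W i) (φ q) (mfderiv I I' φ q (X q))), .sum _ hφ fun i _ ↦ ?_, ?_⟩
  · exact ((hW i).comp hφ).smul (hX.contMDiff_mvfderiv (hf i)) |>.add
      ((hX.mfderiv hφ).cov_apply hcov (hW i) |>.smul (hf i))
  · filter_upwards [hξW.eventually_nhds] with q hq
    rw [covAlong_congr cov hq, covAlong_sum _ hφ fun i ↦ ((hW i).comp hφ).smul (hf i)]
    refine Finset.sum_congr rfl fun i _ ↦ ?_
    rw [covAlong_smul cov (hf i) ((hW i).comp hφ),
      covAlong_comp cov ((hφ q).mdifferentiableAt (by simp)) (hW i)]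

end SmoothCovAlong

section TorsionFree

variable {E : Type*} [NormedAddCommGroup E] [NormedSpace ℝ E] [FiniteDimensional ℝ E]
  {H : Type*} [TopologicalSpace H] {I : ModelWithCorners ℝ E H}
  {M : Type*} [TopologicalSpace M] [ChartedSpace H M] [IsManifold I ∞ M] [T2Space M]
  {E' : Type*} [NormedAddCommGroup E'] [NormedSpace ℝ E'] [FiniteDimensional ℝ E']
  {H' : Type*} [TopologicalSpace H'] {I' : ModelWithCorners ℝ E' H'}
  {N : Type*} [TopologicalSpace N] [ChartedSpace H' N] [IsManifold I' ∞ N]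
  {φ : M → N} {X Y : Π p : M, TangentSpace I p}
  {cov : CovariantDerivative I' E' (fun x : N ↦ TangentSpace I' x)}

lemma cov_sub_cov_eq_mlieBracket (htor : cov.torsion = 0) {U V : Π x : N, TangentSpace I' x}
    (hU : IsSmoothField U) (hV : IsSmoothField V) (x : N) :
    cov V x (U x) - cov U x (V x) = mlieBracket I' U V x := by
  have h := CovariantDerivative.torsion_apply cov (hU.mdifferentiableAt x) (hV.mdifferentiableAt x)
  rw [htor] at h
  exact sub_eq_zero.1 h.symm

lemma tangentCoord_mlieBracket (hX : IsSmoothField X) (hY : IsSmoothField Y) (p : M) :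
    tangentCoord I p p (mlieBracket I X Y p)
      = mvfderiv I (fun q ↦ tangentCoord I p q (Y q)) p (X p)
        - mvfderiv I (fun q ↦ tangentCoord I p q (X q)) p (Y p) := by
  simpa only [mfderiv_id, id_eq] using! tangentCoord_mfderiv_mlieBracket contMDiff_id hX hY p

variable [T2Space N]

lemma connectionForm_comm (htor : cov.torsion = 0) (x : N) (u v : TangentSpace I' x) :
    connectionForm cov x u v = connectionForm cov x v u := by
  obtain ⟨U, hU, rfl⟩ := exists_isSmoothField_apply_eq I' x u
  obtain ⟨V, hV, rfl⟩ := exists_isSmoothField_apply_eq I' x v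
  have hbracket := cov_sub_cov_eq_mlieBracket htor hU hV x
  rw [cov_eq_mvfderiv_add_connectionForm cov (hV.mdifferentiableAt x),
    cov_eq_mvfderiv_add_connectionForm cov (hU.mdifferentiableAt x),
    ← tangentCoordSymm_tangentCoord I' (FiberBundle.mem_baseSet_trivializationAt' x)
      (mlieBracket I' U V x), tangentCoord_mlieBracket hU hV, map_sub] at hbracket
  rw [← sub_eq_zero, ← sub_eq_zero.2 hbracket]
  module

theorem covAlong_mfderiv_sub_covAlong_mfderiv (htor : cov.torsion = 0) (hφ : ContMDiff I I' ∞ φ)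
    (hX : IsSmoothField X) (hY : IsSmoothField Y) (p : M) :
    covAlong I cov φ (fun q ↦ mfderiv I I' φ q (Y q)) p (X p)
      - covAlong I cov φ (fun q ↦ mfderiv I I' φ q (X q)) p (Y p)
      = mfderiv I I' φ p (mlieBracket I X Y p) := by
  have hc := hφ.continuous.continuousAt (x := p)
  rw [covAlong_eq cov hc, covAlong_eq cov hc, connectionForm_comm htor, add_sub_add_right_eq_sub,
    ← map_sub, ← tangentCoord_mfderiv_mlieBracket hφ hX hY p,
    tangentCoordSymm_tangentCoord I' (FiberBundle.mem_baseSet_trivializationAt' (φ p))]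

end TorsionFree

section ParallelAlong

variable {E : Type*} [NormedAddCommGroup E] [NormedSpace ℝ E]
  {H : Type*} [TopologicalSpace H] {I : ModelWithCorners ℝ E H}
  {M : Type*} [TopologicalSpace M] [ChartedSpace H M]
  {E' : Type*} [NormedAddCommGroup E'] [NormedSpace ℝ E']
  {H' : Type*} [TopologicalSpace H'] {I' : ModelWithCorners ℝ E' H'}
  {N : Type*} [TopologicalSpace N] [ChartedSpace H' N] [IsManifold I' ∞ N]
  {φ : M → N} {ξ η : Π p : M, TangentSpace I' (φ p)}

lemma IsSmoothAlong.inner [RiemannianBundle (fun x : N ↦ TangentSpace I' x)]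
    [IsContMDiffRiemannianBundle I' ∞ E' (fun x : N ↦ TangentSpace I' x)]
    (hξ : IsSmoothAlong I I' φ ξ) (hη : IsSmoothAlong I I' φ η) :
    ContMDiff I 𝓘(ℝ, ℝ) ∞ (fun q ↦ ⟪ξ q, η q⟫) :=
  ContMDiff.inner_bundle hξ hη

variable {cov : CovariantDerivative I' E' (fun x : N ↦ TangentSpace I' x)}

lemma isTensorialAlong_covAlong_clm_apply_sub [FiniteDimensional ℝ E']
    {J : Π x : N, TangentSpace I' x →L[ℝ] TangentSpace I' x}
    (hJ : ContMDiff I' (I'.prod 𝓘(ℝ, E' →L[ℝ] E')) ∞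
      (fun x ↦ (⟨x, J x⟩ : TotalSpace (E' →L[ℝ] E')
        (fun x : N ↦ TangentSpace I' x →L[ℝ] TangentSpace I' x)))) {p : M}
    (v : TangentSpace I p) :
    IsTensorialAlong I I' φ p fun ξ ↦
      covAlong I cov φ (fun q ↦ J (φ q) (ξ q)) p v - J (φ p) (covAlong I cov φ ξ p v) where
  congr ξ η _ _ h := by
    rw [covAlong_congr cov h, covAlong_congr cov (h.mono fun q hq ↦ congrArg (J (φ q)) hq)]
  add ξ η hξ hη := by
    simp only [map_add]
    rw [covAlong_add cov (hξ.clm_apply hJ) (hη.clm_apply hJ), covAlong_add cov hξ hη, map_add]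
    module
  smul f ξ hf hξ := by
    simp only [map_smul]
    rw [covAlong_smul cov hf (hξ.clm_apply hJ), covAlong_smul cov hf hξ, map_add, map_smul,
      map_smul]
    module

theorem covAlong_clm_apply_sub [FiniteDimensional ℝ E] [IsManifold I ∞ M] [T2Space M]
    [FiniteDimensional ℝ E'] [T2Space N]
    {J : Π x : N, TangentSpace I' x →L[ℝ] TangentSpace I' x}
    (hJ : ContMDiff I' (I'.prod 𝓘(ℝ, E' →L[ℝ] E')) ∞
      (fun x ↦ (⟨x, J x⟩ : TotalSpace (E' →L[ℝ] E')
        (fun x : N ↦ TangentSpace I' x →L[ℝ] TangentSpace I' x))))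
    (hξ : IsSmoothAlong I I' φ ξ) {V : Π x : N, TangentSpace I' x} (hV : IsSmoothField V) {p : M}
    (hVξ : V (φ p) = ξ p) (v : TangentSpace I p) :
    covAlong I cov φ (fun q ↦ J (φ q) (ξ q)) p v - J (φ p) (covAlong I cov φ ξ p v)
      = cov (fun x ↦ J x (V x)) (φ p) (mfderiv I I' φ p v)
        - J (φ p) (cov V (φ p) (mfderiv I I' φ p v)) := by
  have hφ := (hξ.base p).mdifferentiableAt (by simp)
  have hJV : IsSmoothField (fun x ↦ J x (V x)) :=
    IsSmoothAlong.clm_apply (I := I') (φ := id) hJ hV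
  rw [(isTensorialAlong_covAlong_clm_apply_sub hJ v).congr_apply hξ (hV.comp hξ.base) hVξ.symm,
    covAlong_comp cov hφ hJV, covAlong_comp cov hφ hV]

variable [RiemannianBundle (fun x : N ↦ TangentSpace I' x)]

variable (cov) in
/-- The failure of the metric to be parallel along `φ`, evaluated on two fields along `φ`. -/
noncomputable def metricDefectAlong (p : M) (v : TangentSpace I p)
    (ξ η : Π p : M, TangentSpace I' (φ p)) : ℝ :=
  mvfderiv I (fun q ↦ ⟪ξ q, η q⟫) p v
    - (⟪covAlong I cov φ ξ p v, η p⟫ + ⟪ξ p, covAlong I cov φ η p v⟫)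

lemma metricDefectAlong_comm {p : M} (v : TangentSpace I p) :
    metricDefectAlong cov p v ξ η = metricDefectAlong cov p v η ξ := by
  simp only [metricDefectAlong, real_inner_comm, add_comm]

variable [FiniteDimensional ℝ E']

theorem IsKaehlerStructure.covAlong_apply [FiniteDimensional ℝ E] [IsManifold I ∞ M] [T2Space M]
    [T2Space N]
    {J : Π x : N, TangentSpace I' x →L[ℝ] TangentSpace I' x} (hJ : IsKaehlerStructure cov J)
    (hξ : IsSmoothAlong I I' φ ξ) (p : M) (v : TangentSpace I p) :
    covAlong I cov φ (fun q ↦ J (φ q) (ξ q)) p v = J (φ p) (covAlong I cov φ ξ p v) := by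
  obtain ⟨V, hV, hVξ⟩ := exists_isSmoothField_apply_eq I' (φ p) (ξ p)
  rw [← sub_eq_zero, covAlong_clm_apply_sub hJ.smooth hξ hV hVξ, hJ.parallel V hV, sub_self]

variable [IsContMDiffRiemannianBundle I' ∞ E' (fun x : N ↦ TangentSpace I' x)]

lemma isTensorialAlong_metricDefectAlong (hη : IsSmoothAlong I I' φ η) {p : M}
    (v : TangentSpace I p) :
    IsTensorialAlong I I' φ p (metricDefectAlong cov p v · η) where
  congr ξ ζ _ _ h := by
    have hinner : (fun q ↦ ⟪ξ q, η q⟫) =ᶠ[𝓝 p] fun q ↦ ⟪ζ q, η q⟫ :=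
      h.mono fun q hq ↦ congrArg (fun w ↦ ⟪w, η q⟫) hq
    rw [metricDefectAlong, metricDefectAlong, covAlong_congr cov h, h.self_of_nhds,
      mvfderiv_congr hinner]
  add ξ ζ hξ hζ := by
    simp only [metricDefectAlong, inner_add_left]
    rw [mvfderiv_fun_add ((hξ.inner hη p).mdifferentiableAt (by simp))
      ((hζ.inner hη p).mdifferentiableAt (by simp)), covAlong_add cov hξ hζ, add_apply,
      inner_add_left]
    ring
  smul f ξ hf hξ := by
    simp only [metricDefectAlong, real_inner_smul_left]
    rw [mvfderiv_fun_mul ((hf p).mdifferentiableAt (by simp))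
      ((hξ.inner hη p).mdifferentiableAt (by simp)), covAlong_smul cov hf hξ]
    simp only [add_apply, smul_apply, inner_add_left, real_inner_smul_left, smul_eq_mul]
    ring

lemma IsLeviCivita.metricDefectAlong_comp (hcov : IsLeviCivita cov) (hφ : ContMDiff I I' ∞ φ)
    {W V : Π x : N, TangentSpace I' x} (hW : IsSmoothField W) (hV : IsSmoothField V) {p : M}
    (v : TangentSpace I p) :
    metricDefectAlong cov p v (fun q ↦ W (φ q)) (fun q ↦ V (φ q)) = 0 := by
  have hφp := (hφ p).mdifferentiableAt (n := ∞) (by simp)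
  have hWV : MDifferentiableAt I' 𝓘(ℝ, ℝ) (fun x ↦ ⟪W x, V x⟫) (φ p) :=
    (IsSmoothAlong.inner (I := I') (φ := id) hW hV (φ p)).mdifferentiableAt (by simp)
  rw [metricDefectAlong, mvfderiv_comp_mfderiv hWV hφp, covAlong_comp cov hφp hV,
    covAlong_comp cov hφp hW,
    hcov.metric W V _ (hW.mdifferentiableAt _) (hV.mdifferentiableAt _), sub_self]

variable [FiniteDimensional ℝ E] [IsManifold I ∞ M] [T2Space M] [T2Space N]

theorem IsLeviCivita.mvfderiv_inner (hcov : IsLeviCivita cov) (hξ : IsSmoothAlong I I' φ ξ)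
    (hη : IsSmoothAlong I I' φ η) (p : M) (v : TangentSpace I p) :
    mvfderiv I (fun q ↦ ⟪ξ q, η q⟫) p v
      = ⟪covAlong I cov φ ξ p v, η p⟫ + ⟪ξ p, covAlong I cov φ η p v⟫ := by
  obtain ⟨W, hW, -, hξW⟩ := (isTensorialAlong_metricDefectAlong (cov := cov) hη v).exists_comp_eq hξ
  obtain ⟨V, hV, -, hηV⟩ :=
    (isTensorialAlong_metricDefectAlong (cov := cov) (hW.comp hξ.base) v).exists_comp_eq hη
  have hdefect : metricDefectAlong cov p v ξ η = 0 := by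
    rw [hξW, metricDefectAlong_comm, hηV, hcov.metricDefectAlong_comp hξ.base hV hW]
  exact sub_eq_zero.1 hdefect

end ParallelAlong

section CurvatureAlong

variable {E : Type*} [NormedAddCommGroup E] [NormedSpace ℝ E]
  {H : Type*} [TopologicalSpace H] {I : ModelWithCorners ℝ E H}
  {M : Type*} [TopologicalSpace M] [ChartedSpace H M]
  {E' : Type*} [NormedAddCommGroup E'] [NormedSpace ℝ E']
  {H' : Type*} [TopologicalSpace H'] {I' : ModelWithCorners ℝ E' H'}
  {N : Type*} [TopologicalSpace N] [ChartedSpace H' N] [IsManifold I' ∞ N]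
  {φ : M → N} {ξ η : Π p : M, TangentSpace I' (φ p)} {X Y : Π p : M, TangentSpace I p} {p : M}
  {cov : CovariantDerivative I' E' (fun x : N ↦ TangentSpace I' x)}

variable (cov) in
/-- The curvature of the connection pulled back to the fields along `φ`. -/
noncomputable def curvatureAlong (φ : M → N) (X Y : Π p : M, TangentSpace I p)
    (ξ : Π p : M, TangentSpace I' (φ p)) (p : M) : TangentSpace I' (φ p) :=
  covAlong I cov φ (fun q ↦ covAlong I cov φ ξ q (Y q)) p (X p)
    - covAlong I cov φ (fun q ↦ covAlong I cov φ ξ q (X q)) p (Y p)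
    - covAlong I cov φ ξ p (mlieBracket I X Y p)

lemma curvatureAlong_congr (h : ∀ᶠ q in 𝓝 p, ξ q = η q) :
    curvatureAlong cov φ X Y ξ p = curvatureAlong cov φ X Y η p := by
  have hcov (Z : Π p : M, TangentSpace I p) :
      ∀ᶠ q in 𝓝 p, covAlong I cov φ ξ q (Z q) = covAlong I cov φ η q (Z q) :=
    h.eventually_nhds.mono fun q hq ↦ covAlong_congr cov hq _
  rw [curvatureAlong, curvatureAlong, covAlong_congr cov h, covAlong_congr cov (hcov X),
    covAlong_congr cov (hcov Y)]

variable [FiniteDimensional ℝ E] [IsManifold I ∞ M] [T2Space M] [FiniteDimensional ℝ E'] [T2Space N]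

lemma curvatureAlong_add (hcov : CovariantDerivative.ContMDiffCovariantDerivative cov ∞)
    (hX : IsSmoothField X) (hY : IsSmoothField Y)
    (hξ : IsSmoothAlong I I' φ ξ) (hη : IsSmoothAlong I I' φ η) :
    curvatureAlong cov φ X Y (fun q ↦ ξ q + η q) p
      = curvatureAlong cov φ X Y ξ p + curvatureAlong cov φ X Y η p := by
  simp only [curvatureAlong, covAlong_add cov hξ hη]
  rw [covAlong_add cov (hξ.covAlong hcov hY) (hη.covAlong hcov hY),
    covAlong_add cov (hξ.covAlong hcov hX) (hη.covAlong hcov hX)]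
  module

lemma curvatureAlong_smul (hcov : CovariantDerivative.ContMDiffCovariantDerivative cov ∞)
    (hX : IsSmoothField X) (hY : IsSmoothField Y) {f : M → ℝ} (hf : ContMDiff I 𝓘(ℝ, ℝ) ∞ f)
    (hξ : IsSmoothAlong I I' φ ξ) :
    curvatureAlong cov φ X Y (fun q ↦ f q • ξ q) p = f p • curvatureAlong cov φ X Y ξ p := by
  have hsecond {Z : Π p : M, TangentSpace I p} (hZ : IsSmoothField Z) (v : TangentSpace I p) :
      covAlong I cov φ (fun q ↦ mvfderiv I f q (Z q) • ξ q + f q • covAlong I cov φ ξ q (Z q)) p v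
        = mvfderiv I (fun q ↦ mvfderiv I f q (Z q)) p v • ξ p
          + mvfderiv I f p (Z p) • covAlong I cov φ ξ p v
          + (mvfderiv I f p v • covAlong I cov φ ξ p (Z p)
            + f p • covAlong I cov φ (fun q ↦ covAlong I cov φ ξ q (Z q)) p v) := by
    rw [covAlong_add cov (hξ.smul (hZ.contMDiff_mvfderiv hf)) ((hξ.covAlong hcov hZ).smul hf),
      covAlong_smul cov (hZ.contMDiff_mvfderiv hf) hξ, covAlong_smul cov hf (hξ.covAlong hcov hZ)]
  simp only [curvatureAlong, covAlong_smul cov hf hξ]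
  rw [hsecond hX, hsecond hY, mvfderiv_mlieBracket hf hX hY]
  module

lemma isTensorialAlong_curvatureAlong
    (hcov : CovariantDerivative.ContMDiffCovariantDerivative cov ∞) (hX : IsSmoothField X)
    (hY : IsSmoothField Y) :
    IsTensorialAlong I I' φ p fun ξ ↦ curvatureAlong cov φ X Y ξ p where
  congr _ _ _ _ h := curvatureAlong_congr h
  add _ _ hξ hη := curvatureAlong_add hcov hX hY hξ hη
  smul _ _ hf hξ := curvatureAlong_smul hcov hX hY hf hξ

lemma covAlong_cov_apply (hcov : CovariantDerivative.ContMDiffCovariantDerivative cov ∞)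
    {V W : Π x : N, TangentSpace I' x} (hV : IsSmoothField V) (hW : IsSmoothField W)
    (hξ : IsSmoothAlong I I' φ ξ) (hVξ : V (φ p) = ξ p) (v : TangentSpace I p) :
    covAlong I cov φ (fun q ↦ cov W (φ q) (ξ q)) p v
      = cov W (φ p) (covAlong I cov φ ξ p v)
        + (cov (fun x ↦ cov W x (V x)) (φ p) (mfderiv I I' φ p v)
          - cov W (φ p) (cov V (φ p) (mfderiv I I' φ p v))) :=
  eq_add_of_sub_eq' (covAlong_clm_apply_sub (contMDiff_cov hcov hW) hξ hV hVξ v)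

lemma curvatureAlong_comp (hcov : CovariantDerivative.ContMDiffCovariantDerivative cov ∞)
    (htor : cov.torsion = 0) (hφ : ContMDiff I I' ∞ φ) (hX : IsSmoothField X)
    (hY : IsSmoothField Y) {U V W : Π x : N, TangentSpace I' x} (hU : IsSmoothField U)
    (hV : IsSmoothField V) (hW : IsSmoothField W)
    (hUX : U (φ p) = mfderiv I I' φ p (X p)) (hVY : V (φ p) = mfderiv I I' φ p (Y p)) :
    curvatureAlong cov φ X Y (fun q ↦ W (φ q)) p = affineCurvature cov U V W (φ p) := by
  have hφd (q : M) : MDifferentiableAt I I' φ q := (hφ q).mdifferentiableAt (by simp)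
  simp only [curvatureAlong, affineCurvature, fun q ↦ covAlong_comp cov (hφd q) hW]
  rw [covAlong_cov_apply hcov hV hW (hY.mfderiv hφ) hVY,
    covAlong_cov_apply hcov hU hW (hX.mfderiv hφ) hUX,
    ← covAlong_mfderiv_sub_covAlong_mfderiv htor hφ hX hY, ← cov_sub_cov_eq_mlieBracket htor hU hV,
    ← hUX, ← hVY, map_sub, map_sub]
  module

theorem curvatureAlong_eq (hcov : CovariantDerivative.ContMDiffCovariantDerivative cov ∞)
    (htor : cov.torsion = 0) (hξ : IsSmoothAlong I I' φ ξ) (hX : IsSmoothField X)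
    (hY : IsSmoothField Y) {U V W : Π x : N, TangentSpace I' x} (hU : IsSmoothField U)
    (hV : IsSmoothField V) (hW : IsSmoothField W)
    (hUX : U (φ p) = mfderiv I I' φ p (X p)) (hVY : V (φ p) = mfderiv I I' φ p (Y p))
    (hWξ : W (φ p) = ξ p) :
    curvatureAlong cov φ X Y ξ p = affineCurvature cov U V W (φ p) := by
  rw [(isTensorialAlong_curvatureAlong hcov hX hY).congr_apply hξ (hW.comp hξ.base) hWξ.symm,
    curvatureAlong_comp hcov htor hξ.base hX hY hU hV hW hUX hVY]

end CurvatureAlong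

section AlgebraicCurvature

/-- The symmetries of the curvature tensor `(a, b, c, d) ↦ g(R(a, b) c, d)` of a Kähler manifold at
a point. -/
structure IsKaehlerCurvatureForm {V : Type*} [AddCommGroup V] (J : V →+ V)
    (Q : V → V → V → V → ℝ) : Prop where
  add_first : ∀ a a' b c d, Q (a + a') b c d = Q a b c d + Q a' b c d
  add_third : ∀ a b c c' d, Q a b (c + c') d = Q a b c d + Q a b c' d
  skew_left : ∀ a b c d, Q a b c d = -Q b a c d
  skew_right : ∀ a b c d, Q a b c d = -Q a b d c
  bianchi : ∀ a b c d, Q a b c d + Q b c a d + Q c a b d = 0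
  complex_right : ∀ a b c d, Q a b (J c) (J d) = Q a b c d

namespace IsKaehlerCurvatureForm

section Symmetry

variable {V : Type*} [AddCommGroup V] {J : V →+ V} {Q : V → V → V → V → ℝ}

lemma pair_symm (h : IsKaehlerCurvatureForm J Q) (a b c d : V) : Q a b c d = Q c d a b := by
  have habc := h.bianchi a b c d
  have hbcd := h.bianchi b c d a
  have hcda := h.bianchi c d a b
  have hdab := h.bianchi d a b c
  rw [h.skew_right b c d a, h.skew_right c d b a, h.skew_left d b c a, h.skew_right b d c a,
    neg_neg] at hbcd
  rw [h.skew_right d a c b, h.skew_left a c d b, h.skew_right c a d b, neg_neg] at hcda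
  rw [h.skew_right a b d c] at hdab
  linarith

lemma add_second (h : IsKaehlerCurvatureForm J Q) (a b b' c d : V) :
    Q a (b + b') c d = Q a b c d + Q a b' c d := by
  rw [h.skew_left, h.add_first, h.skew_left b, h.skew_left b', neg_add, neg_neg, neg_neg]

lemma add_fourth (h : IsKaehlerCurvatureForm J Q) (a b c d d' : V) :
    Q a b c (d + d') = Q a b c d + Q a b c d' := by
  rw [h.pair_symm, h.add_second, h.pair_symm, h.pair_symm c d']

lemma neg_first (h : IsKaehlerCurvatureForm J Q) (a b c d : V) : Q (-a) b c d = -Q a b c d :=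
  map_neg (AddMonoidHom.mk' (Q · b c d) fun a a' ↦ h.add_first a a' b c d) a

lemma neg_second (h : IsKaehlerCurvatureForm J Q) (a b c d : V) : Q a (-b) c d = -Q a b c d := by
  rw [h.skew_left, h.neg_first, h.skew_left b, neg_neg]

lemma neg_third (h : IsKaehlerCurvatureForm J Q) (a b c d : V) : Q a b (-c) d = -Q a b c d := by
  rw [h.pair_symm, h.neg_first, h.pair_symm]

lemma neg_fourth (h : IsKaehlerCurvatureForm J Q) (a b c d : V) : Q a b c (-d) = -Q a b c d := by
  rw [h.pair_symm, h.neg_second, h.pair_symm]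

lemma complex_left (h : IsKaehlerCurvatureForm J Q) (a b c d : V) :
    Q (J a) (J b) c d = Q a b c d := by
  rw [h.pair_symm, h.complex_right, h.pair_symm]

end Symmetry

variable {V : Type*} [NormedAddCommGroup V] [InnerProductSpace ℝ V] {J : V →+ V}
  {Q : V → V → V → V → ℝ}

lemma apply_add_three_mul_apply_of_inner_eq_zero (h : IsKaehlerCurvatureForm J Q)
    (hJ : ∀ v, J (J v) = -v) {μ : ℝ} (hμ : ∀ v, Q v (J v) (J v) v = μ * ⟪v, v⟫ ^ 2) {x y : V}
    (hxy : ⟪x, y⟫ = 0) : Q x y y x + 3 * Q x (J y) (J y) x = μ * (⟪x, x⟫ * ⟪y, y⟫) := by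
  have hyx : ⟪y, x⟫ = 0 := by rw [real_inner_comm, hxy]
  have hx_Jy_Jx_y : Q x (J y) (J x) y = Q x (J y) (J y) x := by
    rw [← h.complex_right x (J y) (J x) y, hJ, h.neg_third, h.skew_right x (J y) x, neg_neg]
  have hy_Jx_Jy_x : Q y (J x) (J y) x = Q x (J y) (J y) x := by
    rw [← h.complex_left y (J x) (J y) x, hJ, h.neg_second, ← h.skew_left]
  have hy_Jx_Jx_y : Q y (J x) (J x) y = Q x (J y) (J y) x := by
    rw [← h.complex_left y (J x) (J x) y, hJ, h.neg_second, ← h.skew_left, hx_Jy_Jx_y]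
  have hx_Jx_Jy_y : Q x (J x) (J y) y = Q x y y x + Q x (J y) (J y) x := by
    have hbianchi := h.bianchi x (J x) (J y) y
    rw [h.complex_left, h.skew_left (J y) x, hx_Jy_Jx_y, h.skew_right x y x y] at hbianchi
    linarith
  have hy_Jy_Jx_x : Q y (J y) (J x) x = Q x y y x + Q x (J y) (J y) x := by
    rw [h.pair_symm, h.skew_left, h.skew_right, neg_neg, hx_Jx_Jy_y]
  have hplus := hμ (x + y)
  have hminus := hμ (x + -y)
  simp only [map_add, map_neg, h.add_first, h.add_second, h.add_third, h.add_fourth, h.neg_first,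
    h.neg_second, h.neg_third, h.neg_fourth, inner_add_left, inner_add_right, inner_neg_left,
    inner_neg_right, hxy, hyx, hx_Jy_Jx_y, hy_Jx_Jy_x, hy_Jx_Jx_y, hx_Jx_Jy_y, hy_Jy_Jx_x, hμ x,
    hμ y] at hplus hminus
  linarith

theorem apply_of_inner_eq_zero (h : IsKaehlerCurvatureForm J Q) (hJ : ∀ v, J (J v) = -v)
    (horth : ∀ v w, ⟪J v, J w⟫ = ⟪v, w⟫) {μ : ℝ} (hμ : ∀ v, Q v (J v) (J v) v = μ * ⟪v, v⟫ ^ 2)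
    {x y : V} (hxy : ⟪x, y⟫ = 0) (hxJy : ⟪x, J y⟫ = 0) :
    Q x y y x = μ / 4 * (⟪x, x⟫ * ⟪y, y⟫) := by
  have hy := h.apply_add_three_mul_apply_of_inner_eq_zero hJ hμ hxy
  have hJy := h.apply_add_three_mul_apply_of_inner_eq_zero hJ hμ hxJy
  rw [hJ, h.neg_second, h.neg_third, horth] at hJy
  linarith

end IsKaehlerCurvatureForm

end AlgebraicCurvature

section AmbientCurvature

variable {E : Type*} [NormedAddCommGroup E] [NormedSpace ℝ E]
  {H : Type*} [TopologicalSpace H] {I : ModelWithCorners ℝ E H}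
  {N : Type*} [TopologicalSpace N] [ChartedSpace H N] [IsManifold I ∞ N]
  {cov : CovariantDerivative I E (fun x : N ↦ TangentSpace I x)}
  {J : Π x : N, TangentSpace I x →L[ℝ] TangentSpace I x}
  {U V W U' V' W' : Π x : N, TangentSpace I x} {x : N}

lemma IsSmoothField.add (hU : IsSmoothField U) (hV : IsSmoothField V) :
    IsSmoothField (fun x ↦ U x + V x) :=
  IsSmoothAlong.add (I := I) (φ := id) hU hV

lemma IsSmoothField.clm_apply
    (hJ : ContMDiff I (I.prod 𝓘(ℝ, E →L[ℝ] E)) ∞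
      (fun x ↦ (⟨x, J x⟩ : TotalSpace (E →L[ℝ] E)
        (fun x : N ↦ TangentSpace I x →L[ℝ] TangentSpace I x))))
    (hU : IsSmoothField U) : IsSmoothField (fun x ↦ J x (U x)) :=
  IsSmoothAlong.clm_apply (I := I) (φ := id) hJ hU

lemma cov_add (hU : IsSmoothField U) (hV : IsSmoothField V) (v : TangentSpace I x) :
    cov (fun y ↦ U y + V y) x v = cov U x v + cov V x v :=
  DFunLike.congr_fun
    (cov.isCovariantDerivativeOnUniv.add (hU.mdifferentiableAt x) (hV.mdifferentiableAt x)) v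

lemma cov_sub (hU : IsSmoothField U) (hV : IsSmoothField V) (v : TangentSpace I x) :
    cov (fun y ↦ U y - V y) x v = cov U x v - cov V x v := by
  have hUV : IsSmoothField (fun y ↦ U y - V y) := IsSmoothAlong.sub (I := I) (φ := id) hU hV
  rw [eq_sub_iff_add_eq, ← cov_add hUV hV]
  simp only [sub_add_cancel]

lemma IsSmoothField.inner [RiemannianBundle (fun x : N ↦ TangentSpace I x)]
    [IsContMDiffRiemannianBundle I ∞ E (fun x : N ↦ TangentSpace I x)]
    (hU : IsSmoothField U) (hV : IsSmoothField V) :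
    ContMDiff I 𝓘(ℝ, ℝ) ∞ (fun x ↦ ⟪U x, V x⟫) :=
  IsSmoothAlong.inner (I := I) (φ := id) hU hV

lemma affineCurvature_swap : affineCurvature cov U V W x = -affineCurvature cov V U W x := by
  rw [affineCurvature, affineCurvature, mlieBracket_swap_apply (V := U), map_neg]
  module

lemma affineCurvature_add_right (hcov : CovariantDerivative.ContMDiffCovariantDerivative cov ∞)
    (hU : IsSmoothField U) (hV : IsSmoothField V) (hW : IsSmoothField W) (hW' : IsSmoothField W') :
    affineCurvature cov U V (fun x ↦ W x + W' x) x
      = affineCurvature cov U V W x + affineCurvature cov U V W' x := by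
  simp only [affineCurvature, cov_add hW hW']
  rw [cov_add (hW.cov_apply hcov hV) (hW'.cov_apply hcov hV),
    cov_add (hW.cov_apply hcov hU) (hW'.cov_apply hcov hU)]
  module

lemma IsKaehlerStructure.affineCurvature_apply
    [RiemannianBundle (fun x : N ↦ TangentSpace I x)] (hJ : IsKaehlerStructure cov J)
    (hcov : CovariantDerivative.ContMDiffCovariantDerivative cov ∞)
    (hU : IsSmoothField U) (hV : IsSmoothField V) (hW : IsSmoothField W) (x : N) :
    affineCurvature cov U V (fun x ↦ J x (W x)) x = J x (affineCurvature cov U V W x) := by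
  simp only [affineCurvature, hJ.parallel W hW, map_sub]
  rw [hJ.parallel _ (hW.cov_apply hcov hV), hJ.parallel _ (hW.cov_apply hcov hU)]

variable [FiniteDimensional ℝ E]

lemma affineCurvature_add_left
    (hcov : CovariantDerivative.ContMDiffCovariantDerivative cov ∞)
    (hU : IsSmoothField U) (hU' : IsSmoothField U') (hW : IsSmoothField W) :
    affineCurvature cov (fun x ↦ U x + U' x) V W x
      = affineCurvature cov U V W x + affineCurvature cov U' V W x := by
  have hbracket : mlieBracket I (fun x ↦ U x + U' x) V x
      = mlieBracket I U V x + mlieBracket I U' V x :=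
    mlieBracket_add_left (hU.mdifferentiableAt x) (hU'.mdifferentiableAt x)
  simp only [affineCurvature, map_add, hbracket]
  rw [cov_add (hW.cov_apply hcov hU) (hW.cov_apply hcov hU')]
  module

lemma mlieBracket_mlieBracket_eq_cov
    (hcov : CovariantDerivative.ContMDiffCovariantDerivative cov ∞) (htor : cov.torsion = 0)
    (hU : IsSmoothField U) (hV : IsSmoothField V) (hW : IsSmoothField W) (x : N) :
    mlieBracket I U (mlieBracket I V W) x
      = cov (fun y ↦ cov W y (V y)) x (U x) - cov (fun y ↦ cov V y (W y)) x (U x)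
        - cov U x (mlieBracket I V W x) := by
  have hVW : mlieBracket I V W = fun y ↦ cov W y (V y) - cov V y (W y) :=
    funext fun y ↦ (cov_sub_cov_eq_mlieBracket htor hV hW y).symm
  rw [← cov_sub_cov_eq_mlieBracket htor hU (hV.mlieBracket hW),
    ← cov_sub (hW.cov_apply hcov hV) (hV.cov_apply hcov hW), ← hVW]

lemma affineCurvature_bianchi (hcov : CovariantDerivative.ContMDiffCovariantDerivative cov ∞)
    (htor : cov.torsion = 0) (hU : IsSmoothField U) (hV : IsSmoothField V) (hW : IsSmoothField W)
    (x : N) :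
    affineCurvature cov U V W x + affineCurvature cov V W U x + affineCurvature cov W U V x
      = 0 := by
  have hjacobi := jacobi_mlieBracket (p := x) hU hV hW
  rw [mlieBracket_mlieBracket_eq_cov hcov htor hU hV hW,
    mlieBracket_swap_apply (V := mlieBracket I U V),
    mlieBracket_mlieBracket_eq_cov hcov htor hW hU hV,
    mlieBracket_mlieBracket_eq_cov hcov htor hV hU hW,
    mlieBracket_swap_apply (V := U) (W := W), map_neg] at hjacobi
  rw [← sub_eq_zero] at hjacobi
  rw [affineCurvature, affineCurvature, affineCurvature, ← hjacobi]
  module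

section Metric

variable [RiemannianBundle (fun x : N ↦ TangentSpace I x)]
  [IsContMDiffRiemannianBundle I ∞ E (fun x : N ↦ TangentSpace I x)]

lemma IsLeviCivita.mvfderiv_inner_field (hcov : IsLeviCivita cov) (hU : IsSmoothField U)
    (hV : IsSmoothField V) (x : N) (v : TangentSpace I x) :
    mvfderiv I (fun y ↦ ⟪U y, V y⟫) x v = ⟪cov U x v, V x⟫ + ⟪U x, cov V x v⟫ :=
  hcov.metric U V x (hU.mdifferentiableAt x) (hV.mdifferentiableAt x) v

lemma IsLeviCivita.mvfderiv_mvfderiv_inner (hcov : IsLeviCivita cov) (hU : IsSmoothField U)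
    (hW : IsSmoothField W) (hW' : IsSmoothField W') (x : N) (v : TangentSpace I x) :
    mvfderiv I (fun y ↦ mvfderiv I (fun y ↦ ⟪W y, W' y⟫) y (U y)) x v
      = ⟪cov (fun y ↦ cov W y (U y)) x v, W' x⟫ + ⟪cov W x (U x), cov W' x v⟫
        + (⟪cov W x v, cov W' x (U x)⟫ + ⟪W x, cov (fun y ↦ cov W' y (U y)) x v⟫) := by
  have hcovW := hW.cov_apply hcov.smooth hU
  have hcovW' := hW'.cov_apply hcov.smooth hU
  simp only [hcov.mvfderiv_inner_field hW hW']
  rw [mvfderiv_fun_add ((hcovW.inner hW' x).mdifferentiableAt (by simp))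
    ((hW.inner hcovW' x).mdifferentiableAt (by simp)), add_apply,
    hcov.mvfderiv_inner_field hcovW hW', hcov.mvfderiv_inner_field hW hcovW']

lemma IsLeviCivita.inner_affineCurvature_skew [T2Space N]
    (hcov : IsLeviCivita cov) (hU : IsSmoothField U) (hV : IsSmoothField V) (hW : IsSmoothField W)
    (hW' : IsSmoothField W') (x : N) :
    ⟪affineCurvature cov U V W x, W' x⟫ = -⟪affineCurvature cov U V W' x, W x⟫ := by
  have hbracket := mvfderiv_mlieBracket (hW.inner hW') hU hV x
  rw [hcov.mvfderiv_mvfderiv_inner hU hW hW', hcov.mvfderiv_mvfderiv_inner hV hW hW',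
    hcov.mvfderiv_inner_field hW hW'] at hbracket
  simp only [affineCurvature, inner_sub_left]
  simp only [real_inner_comm _ (W x)] at hbracket ⊢
  linarith

end Metric

variable [T2Space N]

lemma affineCurvature_congr (hcov : CovariantDerivative.ContMDiffCovariantDerivative cov ∞)
    (htor : cov.torsion = 0) (hU : IsSmoothField U) (hV : IsSmoothField V) (hW : IsSmoothField W)
    (hU' : IsSmoothField U') (hV' : IsSmoothField V') (hW' : IsSmoothField W')
    (hUU' : U x = U' x) (hVV' : V x = V' x) (hWW' : W x = W' x) :
    affineCurvature cov U V W x = affineCurvature cov U' V' W' x := by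
  have hid (v : TangentSpace I x) : v = mfderiv I I (id : N → N) x v := by rw [mfderiv_id]; rfl
  calc affineCurvature cov U V W x
    _ = curvatureAlong cov id U V W x :=
      (curvatureAlong_eq (φ := id) hcov htor hW hU hV hU hV hW (hid _) (hid _) rfl).symm
    _ = affineCurvature cov U' V' W' x :=
      curvatureAlong_eq (φ := id) hcov htor hW hU hV hU' hV' hW'
        (hUU'.symm.trans (hid _)) (hVV'.symm.trans (hid _)) hWW'.symm

variable (cov) in
/-- The curvature tensor of the connection `cov`, computed on arbitrary smooth extensions of the
given vectors. -/
noncomputable def curvatureTensor (x : N) (u v w : TangentSpace I x) : TangentSpace I x :=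
  affineCurvature cov (exists_isSmoothField_apply_eq I x u).choose
    (exists_isSmoothField_apply_eq I x v).choose (exists_isSmoothField_apply_eq I x w).choose x

lemma curvatureTensor_eq (hcov : CovariantDerivative.ContMDiffCovariantDerivative cov ∞)
    (htor : cov.torsion = 0) (hU : IsSmoothField U) (hV : IsSmoothField V) (hW : IsSmoothField W)
    (x : N) : curvatureTensor cov x (U x) (V x) (W x) = affineCurvature cov U V W x := by
  have hu := (exists_isSmoothField_apply_eq I x (U x)).choose_spec
  have hv := (exists_isSmoothField_apply_eq I x (V x)).choose_spec
  have hw := (exists_isSmoothField_apply_eq I x (W x)).choose_spec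
  exact affineCurvature_congr hcov htor hu.1 hv.1 hw.1 hU hV hW hu.2 hv.2 hw.2

lemma curvatureTensor_swap (u v w : TangentSpace I x) :
    curvatureTensor cov x u v w = -curvatureTensor cov x v u w :=
  affineCurvature_swap

lemma curvatureTensor_add_left (hcov : CovariantDerivative.ContMDiffCovariantDerivative cov ∞)
    (htor : cov.torsion = 0) (u u' v w : TangentSpace I x) :
    curvatureTensor cov x (u + u') v w
      = curvatureTensor cov x u v w + curvatureTensor cov x u' v w := by
  obtain ⟨U, hU, rfl⟩ := exists_isSmoothField_apply_eq I x u
  obtain ⟨U', hU', rfl⟩ := exists_isSmoothField_apply_eq I x u'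
  obtain ⟨V, hV, rfl⟩ := exists_isSmoothField_apply_eq I x v
  obtain ⟨W, hW, rfl⟩ := exists_isSmoothField_apply_eq I x w
  rw [curvatureTensor_eq hcov htor hU hV hW, curvatureTensor_eq hcov htor hU' hV hW,
    ← affineCurvature_add_left hcov hU hU' hW, ← curvatureTensor_eq hcov htor (hU.add hU') hV hW]

lemma curvatureTensor_add_right (hcov : CovariantDerivative.ContMDiffCovariantDerivative cov ∞)
    (htor : cov.torsion = 0) (u v w w' : TangentSpace I x) :
    curvatureTensor cov x u v (w + w')
      = curvatureTensor cov x u v w + curvatureTensor cov x u v w' := by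
  obtain ⟨U, hU, rfl⟩ := exists_isSmoothField_apply_eq I x u
  obtain ⟨V, hV, rfl⟩ := exists_isSmoothField_apply_eq I x v
  obtain ⟨W, hW, rfl⟩ := exists_isSmoothField_apply_eq I x w
  obtain ⟨W', hW', rfl⟩ := exists_isSmoothField_apply_eq I x w'
  rw [curvatureTensor_eq hcov htor hU hV hW, curvatureTensor_eq hcov htor hU hV hW',
    ← affineCurvature_add_right hcov hU hV hW hW',
    ← curvatureTensor_eq hcov htor hU hV (hW.add hW')]

lemma curvatureTensor_bianchi (hcov : CovariantDerivative.ContMDiffCovariantDerivative cov ∞)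
    (htor : cov.torsion = 0) (u v w : TangentSpace I x) :
    curvatureTensor cov x u v w + curvatureTensor cov x v w u + curvatureTensor cov x w u v
      = 0 := by
  obtain ⟨U, hU, rfl⟩ := exists_isSmoothField_apply_eq I x u
  obtain ⟨V, hV, rfl⟩ := exists_isSmoothField_apply_eq I x v
  obtain ⟨W, hW, rfl⟩ := exists_isSmoothField_apply_eq I x w
  rw [curvatureTensor_eq hcov htor hU hV hW, curvatureTensor_eq hcov htor hV hW hU,
    curvatureTensor_eq hcov htor hW hU hV, affineCurvature_bianchi hcov htor hU hV hW]

variable [RiemannianBundle (fun x : N ↦ TangentSpace I x)]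

lemma IsKaehlerStructure.curvatureTensor_apply (hJ : IsKaehlerStructure cov J)
    (hcov : CovariantDerivative.ContMDiffCovariantDerivative cov ∞) (htor : cov.torsion = 0)
    (u v w : TangentSpace I x) :
    curvatureTensor cov x u v (J x w) = J x (curvatureTensor cov x u v w) := by
  obtain ⟨U, hU, rfl⟩ := exists_isSmoothField_apply_eq I x u
  obtain ⟨V, hV, rfl⟩ := exists_isSmoothField_apply_eq I x v
  obtain ⟨W, hW, rfl⟩ := exists_isSmoothField_apply_eq I x w
  rw [curvatureTensor_eq hcov htor hU hV (hW.clm_apply hJ.smooth),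
    curvatureTensor_eq hcov htor hU hV hW, hJ.affineCurvature_apply hcov hU hV hW]

variable [IsContMDiffRiemannianBundle I ∞ E (fun x : N ↦ TangentSpace I x)]

lemma IsLeviCivita.inner_curvatureTensor_skew (hcov : IsLeviCivita cov)
    (u v w w' : TangentSpace I x) :
    ⟪curvatureTensor cov x u v w, w'⟫ = -⟪curvatureTensor cov x u v w', w⟫ := by
  obtain ⟨U, hU, rfl⟩ := exists_isSmoothField_apply_eq I x u
  obtain ⟨V, hV, rfl⟩ := exists_isSmoothField_apply_eq I x v
  obtain ⟨W, hW, rfl⟩ := exists_isSmoothField_apply_eq I x w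
  obtain ⟨W', hW', rfl⟩ := exists_isSmoothField_apply_eq I x w'
  rw [curvatureTensor_eq hcov.smooth hcov.torsion_free hU hV hW,
    curvatureTensor_eq hcov.smooth hcov.torsion_free hU hV hW',
    hcov.inner_affineCurvature_skew hU hV hW hW']

theorem IsKaehlerStructure.isKaehlerCurvatureForm (hJ : IsKaehlerStructure cov J)
    (hcov : IsLeviCivita cov) (x : N) :
    IsKaehlerCurvatureForm (J x : TangentSpace I x →+ TangentSpace I x)
      (fun a b c d ↦ ⟪curvatureTensor cov x a b c, d⟫) where
  add_first a a' b c d := by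
    rw [curvatureTensor_add_left hcov.smooth hcov.torsion_free, inner_add_left]
  add_third a b c c' d := by
    rw [curvatureTensor_add_right hcov.smooth hcov.torsion_free, inner_add_left]
  skew_left a b c d := by rw [curvatureTensor_swap, inner_neg_left]
  skew_right a b c d := hcov.inner_curvatureTensor_skew a b c d
  bianchi a b c d := by
    rw [← inner_add_left, ← inner_add_left,
      curvatureTensor_bianchi hcov.smooth hcov.torsion_free, inner_zero_left]
  complex_right a b c d := by
    change ⟪curvatureTensor cov x a b (J x c), J x d⟫ = _
    rw [hJ.curvatureTensor_apply hcov.smooth hcov.torsion_free, hJ.orthogonal]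

theorem IsComplexSpaceForm.inner_curvatureTensor_of_inner_eq_zero {μ : ℝ}
    (hN : IsComplexSpaceForm cov J μ) {v w : TangentSpace I x} (hvw : ⟪v, w⟫ = 0)
    (hvJw : ⟪v, J x w⟫ = 0) :
    ⟪curvatureTensor cov x v w w, v⟫ = μ / 4 * (⟪v, v⟫ * ⟪w, w⟫) := by
  refine (hN.kaehler.isKaehlerCurvatureForm hN.leviCivita x).apply_of_inner_eq_zero
    (hN.kaehler.sq x) (hN.kaehler.orthogonal x) (fun v ↦ ?_) hvw hvJw
  obtain ⟨V, hV, rfl⟩ := exists_isSmoothField_apply_eq I x v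
  have hJV := hV.clm_apply hN.kaehler.smooth
  exact (congrArg (fun w ↦ ⟪w, V x⟫) (curvatureTensor_eq hN.leviCivita.smooth
    hN.leviCivita.torsion_free hV hJV hJV x)).trans (hN.holomorphicCurvature V hV x)

end AmbientCurvature

section OrthonormalFrame

lemma gramSchmidt_eq_sub_sum_gramSchmidtNormed {V : Type*} [NormedAddCommGroup V]
    [InnerProductSpace ℝ V] {ι : Type*} [LinearOrder ι] [LocallyFiniteOrderBot ι]
    [WellFoundedLT ι] (f : ι → V) (n : ι) :
    InnerProductSpace.gramSchmidt ℝ f n = f n - ∑ i ∈ Finset.Iio n,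
      ⟪InnerProductSpace.gramSchmidtNormed ℝ f i, f n⟫
        • InnerProductSpace.gramSchmidtNormed ℝ f i := by
  refine eq_sub_of_add_eq (Eq.trans ?_ (InnerProductSpace.gramSchmidt_def'' ℝ f n).symm)
  congr 1
  refine Finset.sum_congr rfl fun i _ ↦ ?_
  rw [InnerProductSpace.gramSchmidtNormed, real_inner_smul_left, smul_smul]
  congr 1
  simp only [RCLike.ofReal_real_eq_id, id_eq]
  ring

variable {E : Type*} [NormedAddCommGroup E] [NormedSpace ℝ E] [FiniteDimensional ℝ E]
  {H : Type*} [TopologicalSpace H] {I : ModelWithCorners ℝ E H}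
  {M : Type*} [TopologicalSpace M] [ChartedSpace H M] [IsManifold I ∞ M] [T2Space M]
  [RiemannianBundle (fun x : M ↦ TangentSpace I x)]
  [IsContMDiffRiemannianBundle I ∞ E (fun x : M ↦ TangentSpace I x)] {p : M}

lemma IsSmoothField.exists_eventuallyEq_inv_norm_smul {Z : Π q : M, TangentSpace I q}
    (hZ : IsSmoothField Z) (hZp : Z p ≠ 0) :
    ∃ U : Π q : M, TangentSpace I q, IsSmoothField U ∧ ∀ᶠ q in 𝓝 p, U q = ‖Z q‖⁻¹ • Z q := by
  have hne : ∀ᶠ q in 𝓝 p, ⟪Z q, Z q⟫ ≠ 0 :=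
    (hZ.inner hZ).continuous.continuousAt.eventually_ne (inner_self_ne_zero.2 hZp)
  obtain ⟨g, hg, hge⟩ := exists_contMDiff_eventuallyEq (I := I) (p := p) (F := ℝ)
    (f := fun q ↦ (√⟪Z q, Z q⟫)⁻¹) (by
      filter_upwards [hne] with q hq
      have hsqrt : ContDiffAt ℝ ∞ (fun t : ℝ ↦ (√t)⁻¹) ⟪Z q, Z q⟫ :=
        (Real.contDiffAt_sqrt hq).inv
          (Real.sqrt_ne_zero'.2 (real_inner_self_nonneg.lt_of_ne' hq))
      exact ContMDiffAt.comp (g := fun t : ℝ ↦ (√t)⁻¹) q hsqrt.contMDiffAt (hZ.inner hZ q))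
  refine ⟨fun q ↦ g q • Z q, IsSmoothAlong.smul (φ := (id : M → M)) hg hZ, ?_⟩
  filter_upwards [hge] with q hq
  rw [hq, norm_eq_sqrt_real_inner]

lemma exists_isSmoothField_eventuallyEq_gramSchmidtNormed {ι : Type*} [LinearOrder ι]
    [LocallyFiniteOrderBot ι] [WellFoundedLT ι] {e : ι → Π q : M, TangentSpace I q}
    (he : ∀ i, IsSmoothField (e i)) (hp : LinearIndependent ℝ fun i ↦ e i p) (n : ι) :
    ∃ G : Π q : M, TangentSpace I q, IsSmoothField G ∧
      ∀ᶠ q in 𝓝 p, G q = InnerProductSpace.gramSchmidtNormed ℝ (fun i ↦ e i q) n := by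
  induction n using WellFoundedLT.induction with
  | ind n ih =>
    choose! G hG hGe using ih
    let Z : Π q : M, TangentSpace I q := fun q ↦
      e n q - ∑ i ∈ Finset.Iio n, ⟪G i q, e n q⟫ • G i q
    have hZ : IsSmoothField Z :=
      IsSmoothAlong.sub (φ := (id : M → M)) (I := I) (he n)
        (IsSmoothAlong.sum (φ := (id : M → M)) (I := I) _ contMDiff_id fun i hi ↦
          have hGi := hG i (Finset.mem_Iio.1 hi)
          IsSmoothAlong.smul (φ := (id : M → M)) (hGi.inner (he n)) hGi)
    have hZe : ∀ᶠ q in 𝓝 p, Z q = InnerProductSpace.gramSchmidt ℝ (fun i ↦ e i q) n := by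
      filter_upwards [(Finset.eventually_all (Finset.Iio n)).2
        fun i hi ↦ hGe i (Finset.mem_Iio.1 hi)] with q hq
      rw [gramSchmidt_eq_sub_sum_gramSchmidtNormed]
      exact congrArg (e n q - ·) (Finset.sum_congr rfl fun i hi ↦ by rw [hq i hi])
    have hZp : Z p ≠ 0 := hZe.self_of_nhds ▸ InnerProductSpace.gramSchmidt_ne_zero n hp
    obtain ⟨U, hU, hUe⟩ := hZ.exists_eventuallyEq_inv_norm_smul hZp
    refine ⟨U, hU, ?_⟩
    filter_upwards [hUe, hZe] with q hUq hZq
    rw [hUq, hZq, InnerProductSpace.gramSchmidtNormed, RCLike.ofReal_real_eq_id, id_eq]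

variable (I) in
theorem exists_isSmoothField_eventually_orthonormalBasis (p : M) :
    ∃ e : Fin (finrank ℝ E) → Π q : M, TangentSpace I q, (∀ i, IsSmoothField (e i)) ∧
      ∀ᶠ q in 𝓝 p, ∃ b : OrthonormalBasis (Fin (finrank ℝ E)) ℝ (TangentSpace I q),
        ∀ i, b i = e i q := by
  choose W hW hWb using fun i ↦
    exists_isSmoothField_eventuallyEq_tangentCoordSymm I p (finBasis ℝ E i)
  have hind : ∀ᶠ q in 𝓝 p, LinearIndependent ℝ fun i ↦ W i q := by
    filter_upwards [Filter.eventually_all.2 hWb, eventually_mem_baseSet I p] with q hWq hq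
    refine LinearIndependent.of_comp (tangentCoord I p q) ?_
    convert! (finBasis ℝ E).linearIndependent using 1
    ext i
    rw [Function.comp_apply, hWq, tangentCoord_tangentCoordSymm I hq]
  choose e he hee using
    exists_isSmoothField_eventuallyEq_gramSchmidtNormed hW hind.self_of_nhds
  refine ⟨e, he, ?_⟩
  filter_upwards [hind, Filter.eventually_all.2 hee] with q hq heq
  have horth : Orthonormal ℝ fun i ↦ e i q := by
    simpa only [heq] using InnerProductSpace.gramSchmidtNormed_orthonormal hq
  refine ⟨OrthonormalBasis.mk horth (horth.linearIndependent.span_eq_top_of_card_eq_finrank'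
    (Fintype.card_fin _)).ge, fun i ↦ by rw [OrthonormalBasis.coe_mk]⟩

end OrthonormalFrame

section Projections

variable {E : Type*} [NormedAddCommGroup E] [NormedSpace ℝ E] [FiniteDimensional ℝ E]
  {H : Type*} [TopologicalSpace H] {I : ModelWithCorners ℝ E H}
  {M : Type*} [TopologicalSpace M] [ChartedSpace H M]
  {E' : Type*} [NormedAddCommGroup E'] [NormedSpace ℝ E'] [FiniteDimensional ℝ E']
  {H' : Type*} [TopologicalSpace H'] {I' : ModelWithCorners ℝ E' H'}
  {N : Type*} [TopologicalSpace N] [ChartedSpace H' N]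
  [RiemannianBundle (fun x : M ↦ TangentSpace I x)]
  [RiemannianBundle (fun x : N ↦ TangentSpace I' x)]
  {φ : M → N} {ξ : Π p : M, TangentSpace I' (φ p)} {p : M}

lemma inner_tangentialPart (w : TangentSpace I' (φ p)) (v : TangentSpace I p) :
    ⟪tangentialPart I I' φ p w, v⟫ = ⟪w, mfderiv I I' φ p v⟫ :=
  LinearMap.adjoint_inner_left _ v w

lemma normalPart_add (v w : TangentSpace I' (φ p)) :
    normalPart I I' φ p (v + w) = normalPart I I' φ p v + normalPart I I' φ p w := by
  simp only [normalPart, map_add]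
  module

lemma normalPart_smul (c : ℝ) (v : TangentSpace I' (φ p)) :
    normalPart I I' φ p (c • v) = c • normalPart I I' φ p v := by
  simp only [normalPart, map_smul]
  module

lemma normalPart_sub (v w : TangentSpace I' (φ p)) :
    normalPart I I' φ p (v - w) = normalPart I I' φ p v - normalPart I I' φ p w := by
  simp only [normalPart, map_sub]
  module

lemma normalPart_eq_self {w : TangentSpace I' (φ p)}
    (hw : ∀ v : TangentSpace I p, ⟪w, mfderiv I I' φ p v⟫ = 0) :
    normalPart I I' φ p w = w := by
  have htangential : tangentialPart I I' φ p w = 0 :=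
    ext_inner_right ℝ fun v ↦ by rw [inner_tangentialPart, hw, inner_zero_left]
  rw [normalPart, htangential, map_zero, sub_zero]

lemma inner_normalPart_of_forall_inner_eq_zero {η : TangentSpace I' (φ p)}
    (hη : ∀ v : TangentSpace I p, ⟪η, mfderiv I I' φ p v⟫ = 0) (w : TangentSpace I' (φ p)) :
    ⟪normalPart I I' φ p w, η⟫ = ⟪w, η⟫ := by
  rw [normalPart, inner_sub_left, real_inner_comm _ (mfderiv I I' φ p _), hη, sub_zero]

lemma tangentialPart_mfderiv (hφ : IsIsometricImmersion I I' φ) (v : TangentSpace I p) :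
    tangentialPart I I' φ p (mfderiv I I' φ p v) = v :=
  ext_inner_right ℝ fun w ↦ by rw [inner_tangentialPart, hφ.isometric]

lemma normalPart_mfderiv (hφ : IsIsometricImmersion I I' φ) (v : TangentSpace I p) :
    normalPart I I' φ p (mfderiv I I' φ p v) = 0 := by
  rw [normalPart, tangentialPart_mfderiv hφ, sub_self]

lemma inner_normalPart_mfderiv (hφ : IsIsometricImmersion I I' φ) (w : TangentSpace I' (φ p))
    (v : TangentSpace I p) : ⟪normalPart I I' φ p w, mfderiv I I' φ p v⟫ = 0 := by
  rw [normalPart, inner_sub_left, hφ.isometric, inner_tangentialPart, sub_self]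

variable [IsManifold I ∞ M] [T2Space M] [IsManifold I' ∞ N]
  [IsContMDiffRiemannianBundle I ∞ E (fun x : M ↦ TangentSpace I x)]
  [IsContMDiffRiemannianBundle I' ∞ E' (fun x : N ↦ TangentSpace I' x)]

lemma IsSmoothAlong.tangentialPart (hξ : IsSmoothAlong I I' φ ξ) :
    IsSmoothField (fun q ↦ tangentialPart I I' φ q (ξ q)) := by
  refine isSmoothAlong_of_eventuallyEq (φ := (id : M → M)) fun p ↦ ?_
  obtain ⟨e, he, h⟩ := exists_isSmoothField_eventually_orthonormalBasis I p
  refine ⟨fun q ↦ ∑ i, ⟪mfderiv I I' φ q (e i q), ξ q⟫ • e i q,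
    IsSmoothAlong.sum (φ := (id : M → M)) (I := I) _ contMDiff_id fun i _ ↦
      IsSmoothAlong.smul (φ := (id : M → M)) (((he i).mfderiv hξ.base).inner hξ) (he i), ?_⟩
  filter_upwards [h] with q hq
  obtain ⟨b, hb⟩ := hq
  refine (b.sum_repr' (_root_.tangentialPart I I' φ q (ξ q))).symm.trans
    (Finset.sum_congr rfl fun i _ ↦ ?_)
  rw [hb, real_inner_comm, inner_tangentialPart, real_inner_comm]

lemma IsSmoothAlong.normalPart (hξ : IsSmoothAlong I I' φ ξ) :
    IsSmoothAlong I I' φ (fun q ↦ normalPart I I' φ q (ξ q)) :=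
  hξ.sub (hξ.tangentialPart.mfderiv hξ.base)

lemma IsIsometricImmersion.exists_isNormalField_apply_eq [T2Space N]
    (hφ : IsIsometricImmersion I I' φ) {w : TangentSpace I' (φ p)}
    (hw : ∀ v : TangentSpace I p, ⟪w, mfderiv I I' φ p v⟫ = 0) :
    ∃ ξ, IsNormalField I I' φ ξ ∧ ξ p = w := by
  obtain ⟨W, hW, hWw⟩ := exists_isSmoothField_apply_eq I' (φ p) w
  refine ⟨_, ⟨(hW.comp hφ.smooth).normalPart,
    fun q v ↦ inner_normalPart_mfderiv hφ (W (φ q)) v⟩, ?_⟩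
  rw [hWw, normalPart_eq_self hw]

end Projections

section GaussWeingarten

variable {E : Type*} [NormedAddCommGroup E] [NormedSpace ℝ E] [FiniteDimensional ℝ E]
  {H : Type*} [TopologicalSpace H] {I : ModelWithCorners ℝ E H}
  {M : Type*} [TopologicalSpace M] [ChartedSpace H M]
  {E' : Type*} [NormedAddCommGroup E'] [NormedSpace ℝ E'] [FiniteDimensional ℝ E']
  {H' : Type*} [TopologicalSpace H'] {I' : ModelWithCorners ℝ E' H'}
  {N : Type*} [TopologicalSpace N] [ChartedSpace H' N] [IsManifold I' ∞ N]
  [RiemannianBundle (fun x : M ↦ TangentSpace I x)]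
  [RiemannianBundle (fun x : N ↦ TangentSpace I' x)]
  {φ : M → N} {ξ η : Π p : M, TangentSpace I' (φ p)} {X Y : Π p : M, TangentSpace I p} {p : M}
  {cov : CovariantDerivative I' E' (fun x : N ↦ TangentSpace I' x)}

lemma normalConnection_eq_covAlong_add (φ : M → N) (ξ : Π p : M, TangentSpace I' (φ p)) (p : M)
    (v : TangentSpace I p) :
    normalConnection cov φ ξ p v
      = covAlong I cov φ ξ p v + mfderiv I I' φ p (shapeOperator cov φ ξ p v) := by
  rw [normalConnection, normalPart, shapeOperator, map_neg, sub_eq_add_neg]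

variable [IsManifold I ∞ M]

lemma isTensorialAlong_normalPart_covAlong_mfderiv (hφ : IsIsometricImmersion I I' φ)
    (v : TangentSpace I p) :
    IsTensorialAlong I I (id : M → M) p
      fun W ↦ normalPart I I' φ p (covAlong I cov φ (fun q ↦ mfderiv I I' φ q (W q)) p v) where
  congr W W' _ _ h :=
    congrArg _ (covAlong_congr cov (h.mono fun q hq ↦ congrArg (mfderiv I I' φ q) hq) v)
  add W W' hW hW' := by
    rw [← normalPart_add, ← covAlong_add cov (IsSmoothField.mfderiv hφ.smooth hW)
      (IsSmoothField.mfderiv hφ.smooth hW')]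
    simp only [map_add]
  smul f W hf hW := by
    have hdφ : (fun q ↦ mfderiv I I' φ q (f q • W q)) = fun q ↦ f q • mfderiv I I' φ q (W q) :=
      funext fun q ↦ map_smul _ _ _
    have hleibniz := covAlong_smul cov (p := p) hf (IsSmoothField.mfderiv hφ.smooth hW) v
    refine (congrArg (fun ζ ↦ normalPart I I' φ p (covAlong I cov φ ζ p v)) hdφ).trans ?_
    rw [hleibniz, normalPart_add, normalPart_smul, normalPart_smul]
    exact (congrArg (· + _) ((congrArg _ (normalPart_mfderiv hφ _)).trans (smul_zero _))).trans
      (zero_add _)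

variable [T2Space M]

theorem normalPart_covAlong_mfderiv (hφ : IsIsometricImmersion I I' φ) (hX : IsSmoothField X)
    (v : TangentSpace I p) :
    normalPart I I' φ p (covAlong I cov φ (fun q ↦ mfderiv I I' φ q (X q)) p v)
      = secondFundamentalForm cov φ p v (X p) := by
  obtain ⟨W, hW, hWX⟩ := exists_isSmoothField_eventuallyEq_extend I p (X p)
  have hWp : W p = X p := by rw [hWX.self_of_nhds, FiberBundle.extend_apply_self]
  refine ((isTensorialAlong_normalPart_covAlong_mfderiv hφ v).congr_apply hX hW hWp.symm).trans ?_
  exact congrArg _ (covAlong_congr cov (hWX.mono fun q hq ↦ congrArg (mfderiv I I' φ q) hq) v)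

lemma exists_linearMap_secondFundamentalForm_apply (hφ : IsIsometricImmersion I I' φ)
    (v : TangentSpace I p) :
    ∃ L : TangentSpace I p →ₗ[ℝ] TangentSpace I' (φ p),
      ∀ w, secondFundamentalForm cov φ p v w = L w := by
  obtain ⟨L, hL⟩ := (isTensorialAlong_normalPart_covAlong_mfderiv (cov := cov) hφ
    v).exists_linearMap contMDiff_id
  refine ⟨L, fun w ↦ ?_⟩
  obtain ⟨W, hW, rfl⟩ := exists_isSmoothField_apply_eq I p w
  rw [← normalPart_covAlong_mfderiv hφ hW]
  exact hL W hW

lemma secondFundamentalForm_add_right (hφ : IsIsometricImmersion I I' φ)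
    (u v w : TangentSpace I p) :
    secondFundamentalForm cov φ p u (v + w)
      = secondFundamentalForm cov φ p u v + secondFundamentalForm cov φ p u w := by
  obtain ⟨L, hL⟩ := exists_linearMap_secondFundamentalForm_apply (cov := cov) hφ u
  rw [hL, hL, hL, map_add]

lemma secondFundamentalForm_smul_right (hφ : IsIsometricImmersion I I' φ)
    (c : ℝ) (u v : TangentSpace I p) :
    secondFundamentalForm cov φ p u (c • v) = c • secondFundamentalForm cov φ p u v := by
  obtain ⟨L, hL⟩ := exists_linearMap_secondFundamentalForm_apply (cov := cov) hφ u
  rw [hL, hL, map_smul]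

variable [T2Space N]

theorem secondFundamentalForm_symm (htor : cov.torsion = 0) (hφ : IsIsometricImmersion I I' φ)
    (u v : TangentSpace I p) :
    secondFundamentalForm cov φ p u v = secondFundamentalForm cov φ p v u := by
  obtain ⟨X, hX, rfl⟩ := exists_isSmoothField_apply_eq I p u
  obtain ⟨Y, hY, rfl⟩ := exists_isSmoothField_apply_eq I p v
  rw [← normalPart_covAlong_mfderiv hφ hX, ← normalPart_covAlong_mfderiv hφ hY, ← sub_eq_zero,
    ← normalPart_sub, covAlong_mfderiv_sub_covAlong_mfderiv htor hφ.smooth hX hY,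
    normalPart_mfderiv hφ]

variable (cov) in
/-- The second fundamental form at `p` as a bilinear map. -/
noncomputable def secondFundamentalFormBilin (htor : cov.torsion = 0)
    (hφ : IsIsometricImmersion I I' φ) (p : M) :
    TangentSpace I p →ₗ[ℝ] TangentSpace I p →ₗ[ℝ] TangentSpace I' (φ p) :=
  LinearMap.mk₂ ℝ (secondFundamentalForm cov φ p)
    (fun u v w ↦ by
      rw [secondFundamentalForm_symm htor hφ, secondFundamentalForm_add_right hφ,
        secondFundamentalForm_symm htor hφ w, secondFundamentalForm_symm htor hφ w])
    (fun c u v ↦ by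
      rw [secondFundamentalForm_symm htor hφ, secondFundamentalForm_smul_right hφ,
        secondFundamentalForm_symm htor hφ v])
    (secondFundamentalForm_add_right hφ) (secondFundamentalForm_smul_right hφ)

theorem meanCurvature_eq_smul_sum (htor : cov.torsion = 0) (hφ : IsIsometricImmersion I I' φ)
    {ι : Type*} [Fintype ι] (b : OrthonormalBasis ι ℝ (TangentSpace I p)) :
    meanCurvature I cov φ p
      = (finrank ℝ E : ℝ)⁻¹ • ∑ i, secondFundamentalForm cov φ p (b i) (b i) := by
  let b₀ := stdOrthonormalBasis ℝ (TangentSpace I p)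
  have htensor : ∑ i, b₀ i ⊗ₜ[ℝ] b₀ i = ∑ i, b i ⊗ₜ[ℝ] b i :=
    (InnerProductSpace.canonicalCovariantTensor_eq_sum _ b₀).symm.trans
      (InnerProductSpace.canonicalCovariantTensor_eq_sum _ b)
  have htrace := congrArg (TensorProduct.lift (secondFundamentalFormBilin cov htor hφ p)) htensor
  simp only [map_sum, TensorProduct.lift.tmul, secondFundamentalFormBilin,
    LinearMap.mk₂_apply] at htrace
  rw [meanCurvature, htrace]

variable [IsContMDiffRiemannianBundle I' ∞ E' (fun x : N ↦ TangentSpace I' x)]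

theorem IsLeviCivita.inner_secondFundamentalForm (hcov : IsLeviCivita cov)
    (hφ : IsIsometricImmersion I I' φ) (hξ : IsNormalField I I' φ ξ) (v w : TangentSpace I p) :
    ⟪secondFundamentalForm cov φ p v w, ξ p⟫ = ⟪shapeOperator cov φ ξ p v, w⟫ := by
  obtain ⟨W, hW, rfl⟩ := exists_isSmoothField_apply_eq I p w
  have horth : ⟪covAlong I cov φ ξ p v, mfderiv I I' φ p (W p)⟫
      + ⟪ξ p, covAlong I cov φ (fun q ↦ mfderiv I I' φ q (W q)) p v⟫ = 0 := by
    rw [← hcov.mvfderiv_inner hξ.smooth (hW.mfderiv hφ.smooth) p v]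
    simp only [hξ.normal, mvfderiv_const]
    rfl
  rw [← normalPart_covAlong_mfderiv hφ hW, inner_normalPart_of_forall_inner_eq_zero (hξ.normal p),
    shapeOperator, inner_neg_left, inner_tangentialPart, real_inner_comm]
  exact (neg_eq_of_add_eq_zero_right horth).symm

theorem IsLeviCivita.inner_shapeOperator_comm (hcov : IsLeviCivita cov)
    (hφ : IsIsometricImmersion I I' φ) (hξ : IsNormalField I I' φ ξ) (v w : TangentSpace I p) :
    ⟪shapeOperator cov φ ξ p v, w⟫ = ⟪v, shapeOperator cov φ ξ p w⟫ := by
  rw [← hcov.inner_secondFundamentalForm hφ hξ, secondFundamentalForm_symm hcov.torsion_free hφ,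
    hcov.inner_secondFundamentalForm hφ hξ, real_inner_comm]

variable [IsContMDiffRiemannianBundle I ∞ E (fun x : M ↦ TangentSpace I x)]

theorem IsLeviCivita.isSmoothField_shapeOperator (hcov : IsLeviCivita cov)
    (hξ : IsSmoothAlong I I' φ ξ) (hX : IsSmoothField X) :
    IsSmoothField (fun q ↦ shapeOperator cov φ ξ q (X q)) :=
  IsSmoothAlong.neg (φ := (id : M → M)) (I := I)
    (hξ.covAlong hcov.smooth hX).tangentialPart

theorem IsLeviCivita.inner_normalConnection_normalConnection (hcov : IsLeviCivita cov)
    (hφ : IsIsometricImmersion I I' φ) (hξ : IsNormalField I I' φ ξ) (hη : IsNormalField I I' φ η)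
    (hX : IsSmoothField X) (v : TangentSpace I p) :
    ⟪normalConnection cov φ (fun q ↦ normalConnection cov φ ξ q (X q)) p v, η p⟫
      = ⟪covAlong I cov φ (fun q ↦ covAlong I cov φ ξ q (X q)) p v, η p⟫
        + ⟪shapeOperator cov φ η p v, shapeOperator cov φ ξ p (X p)⟫ := by
  have hA := hcov.isSmoothField_shapeOperator hξ.smooth hX
  have hweingarten : (fun q ↦ normalConnection cov φ ξ q (X q)) = fun q ↦
      covAlong I cov φ ξ q (X q) + mfderiv I I' φ q (shapeOperator cov φ ξ q (X q)) :=
    funext fun q ↦ normalConnection_eq_covAlong_add φ ξ q (X q)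
  rw [normalConnection, hweingarten, covAlong_add cov (hξ.smooth.covAlong hcov.smooth hX)
    (hA.mfderiv hφ.smooth), normalPart_add, inner_add_left, normalPart_covAlong_mfderiv hφ hA,
    hcov.inner_secondFundamentalForm hφ hη, inner_normalPart_of_forall_inner_eq_zero (hη.normal p)]

theorem IsLeviCivita.inner_normalCurvature (hcov : IsLeviCivita cov)
    (hφ : IsIsometricImmersion I I' φ) (hξ : IsNormalField I I' φ ξ) (hη : IsNormalField I I' φ η)
    (hX : IsSmoothField X) (hY : IsSmoothField Y) (p : M) :
    ⟪normalCurvature cov φ X Y ξ p, η p⟫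
      = ⟪curvatureTensor cov (φ p) (mfderiv I I' φ p (X p)) (mfderiv I I' φ p (Y p)) (ξ p), η p⟫
        + (⟪shapeOperator cov φ η p (X p), shapeOperator cov φ ξ p (Y p)⟫
          - ⟪shapeOperator cov φ η p (Y p), shapeOperator cov φ ξ p (X p)⟫) := by
  obtain ⟨U, hU, hUp⟩ := exists_isSmoothField_apply_eq I' (φ p) (mfderiv I I' φ p (X p))
  obtain ⟨V, hV, hVp⟩ := exists_isSmoothField_apply_eq I' (φ p) (mfderiv I I' φ p (Y p))
  obtain ⟨W, hW, hWp⟩ := exists_isSmoothField_apply_eq I' (φ p) (ξ p)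
  have hR : curvatureAlong cov φ X Y ξ p
      = curvatureTensor cov (φ p) (mfderiv I I' φ p (X p)) (mfderiv I I' φ p (Y p)) (ξ p) := by
    rw [curvatureAlong_eq hcov.smooth hcov.torsion_free hξ.smooth hX hY hU hV hW hUp hVp hWp,
      ← curvatureTensor_eq hcov.smooth hcov.torsion_free hU hV hW, hUp, hVp, hWp]
  rw [← hR, normalCurvature, inner_sub_left, inner_sub_left,
    hcov.inner_normalConnection_normalConnection hφ hξ hη hY,
    hcov.inner_normalConnection_normalConnection hφ hξ hη hX, normalConnection,
    inner_normalPart_of_forall_inner_eq_zero (hη.normal p), curvatureAlong, inner_sub_left,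
    inner_sub_left]
  ring

theorem IsLeviCivita.inner_normalCurvature_of_commute (hcov : IsLeviCivita cov)
    (hφ : IsIsometricImmersion I I' φ) (hcomm : HasCommutativeSecondFundamentalForms I cov φ)
    (hξ : IsNormalField I I' φ ξ) (hη : IsNormalField I I' φ η)
    (hX : IsSmoothField X) (hY : IsSmoothField Y) (p : M) :
    ⟪normalCurvature cov φ X Y ξ p, η p⟫
      = ⟪curvatureTensor cov (φ p) (mfderiv I I' φ p (X p)) (mfderiv I I' φ p (Y p)) (ξ p),
        η p⟫ := by
  rw [hcov.inner_normalCurvature hφ hξ hη hX hY, hcov.inner_shapeOperator_comm hφ hη (X p),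
    ← hcomm ξ η hξ hη, ← hcov.inner_shapeOperator_comm hφ hξ,
    real_inner_comm (shapeOperator cov φ η p (Y p)), sub_self, add_zero]

theorem IsLeviCivita.isNormalField_meanCurvature (hcov : IsLeviCivita cov)
    (hφ : IsIsometricImmersion I I' φ) : IsNormalField I I' φ (meanCurvature I cov φ) where
  smooth := isSmoothAlong_of_eventuallyEq fun p ↦ by
    obtain ⟨e, he, heb⟩ := exists_isSmoothField_eventually_orthonormalBasis I p
    refine ⟨_, IsSmoothAlong.const_smul (finrank ℝ E : ℝ)⁻¹ (IsSmoothAlong.sum Finset.univ hφ.smooth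
      fun i _ ↦ (((he i).mfderiv hφ.smooth).covAlong hcov.smooth (he i)).normalPart), ?_⟩
    filter_upwards [heb] with q ⟨b, hb⟩
    simp only [meanCurvature_eq_smul_sum hcov.torsion_free hφ b, hb,
      normalPart_covAlong_mfderiv hφ (he _)]
  normal p v := by
    simp only [meanCurvature, real_inner_smul_left, sum_inner, secondFundamentalForm,
      inner_normalPart_mfderiv hφ, Finset.sum_const_zero, mul_zero]

end GaussWeingarten

section InnerProductSpace

variable {V : Type*} [NormedAddCommGroup V] [InnerProductSpace ℝ V]

lemma exists_ne_zero_inner_eq_zero [FiniteDimensional ℝ V] (hdim : 1 < finrank ℝ V) (y : V) :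
    ∃ x : V, x ≠ 0 ∧ ⟪x, y⟫ = 0 := by
  obtain ⟨x, hxy, hx⟩ := (Submodule.ne_bot_iff _).1
    (LinearMap.ker_ne_bot_of_finrank_lt (f := innerₛₗ ℝ y) (by rwa [finrank_self]))
  exact ⟨x, hx, by rwa [real_inner_comm]⟩

lemma eq_zero_of_sum_apply_self_eq_zero {B : V → V → V} (hsymm : ∀ v w, B v w = B w v)
    (hinner : ∀ u v w, ⟪B u v, w⟫ = ⟪u, B w v⟫) (hcomm : ∀ u v w, B (B u v) w = B (B u w) v)
    {ι : Type*} [Fintype ι] (b : OrthonormalBasis ι ℝ V) (hsum : ∑ i, B (b i) (b i) = 0)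
    (u v : V) : B u v = 0 := by
  have hnorm (i : ι) : ⟪B u (b i), B u (b i)⟫ = ⟪B u u, B (b i) (b i)⟫ := by
    rw [hinner, hsymm u (b i), hcomm, ← hinner]
  have hsum_norm : ∑ i, ⟪B u (b i), B u (b i)⟫ = 0 := by
    simp only [hnorm, ← inner_sum, hsum, inner_zero_right]
  have hbasis (i : ι) : B u (b i) = 0 := inner_self_eq_zero.1
    ((Finset.sum_eq_zero_iff_of_nonneg fun i _ ↦ real_inner_self_nonneg).1 hsum_norm i
      (Finset.mem_univ i))
  refine InnerProductSpace.ext_inner_right_basis b.toBasis fun i ↦ ?_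
  rw [b.coe_toBasis, hsymm, hinner, hsymm, hbasis, inner_zero_right, inner_zero_left]

end InnerProductSpace

section TotallyReal

variable {E : Type*} [NormedAddCommGroup E] [NormedSpace ℝ E] [FiniteDimensional ℝ E]
  {H : Type*} [TopologicalSpace H] {I : ModelWithCorners ℝ E H}
  {M : Type*} [TopologicalSpace M] [ChartedSpace H M] [IsManifold I ∞ M] [T2Space M]
  {E' : Type*} [NormedAddCommGroup E'] [NormedSpace ℝ E'] [FiniteDimensional ℝ E']
  {H' : Type*} [TopologicalSpace H'] {I' : ModelWithCorners ℝ E' H'}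
  {N : Type*} [TopologicalSpace N] [ChartedSpace H' N] [IsManifold I' ∞ N] [T2Space N]
  [RiemannianBundle (fun x : M ↦ TangentSpace I x)]
  [RiemannianBundle (fun x : N ↦ TangentSpace I' x)]
  {cov : CovariantDerivative I' E' (fun x : N ↦ TangentSpace I' x)}
  {J : Π x : N, TangentSpace I' x →L[ℝ] TangentSpace I' x}
  {φ : M → N} {ξ : Π p : M, TangentSpace I' (φ p)} {p : M} {μ : ℝ}

/-- The product `v, w ↦ -(J σ(v, w))ᵀ` on the tangent space at `p`. On a totally real submanifold
with parallel `f`-structure it encodes both the second fundamental form, `σ(v, w) = J (v · w)`, and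
the shape operators, `v · w = A_{Jw} v`. -/
noncomputable def tangentProduct
    (cov : CovariantDerivative I' E' (fun x : N ↦ TangentSpace I' x)) (φ : M → N)
    (J : Π x : N, TangentSpace I' x →L[ℝ] TangentSpace I' x) (p : M) (v w : TangentSpace I p) :
    TangentSpace I p :=
  -tangentialPart I I' φ p (J (φ p) (secondFundamentalForm cov φ p v w))

lemma tangentProduct_comm (htor : cov.torsion = 0) (hφ : IsIsometricImmersion I I' φ)
    (v w : TangentSpace I p) : tangentProduct cov φ J p v w = tangentProduct cov φ J p w v := by
  rw [tangentProduct, secondFundamentalForm_symm htor hφ, tangentProduct]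

variable [IsContMDiffRiemannianBundle I ∞ E (fun x : M ↦ TangentSpace I x)]
  [IsContMDiffRiemannianBundle I' ∞ E' (fun x : N ↦ TangentSpace I' x)]

theorem secondFundamentalForm_eq_of_parallel (hJ : IsKaehlerStructure cov J)
    (hφ : IsIsometricImmersion I I' φ) (hreal : IsTotallyReal I φ J)
    (hf : HasParallelNormalFStructure I cov φ J) (hξ : IsNormalField I I' φ ξ)
    {w : TangentSpace I p} (hξw : ξ p = J (φ p) (mfderiv I I' φ p w)) (v : TangentSpace I p) :
    secondFundamentalForm cov φ p v w
      = J (φ p) (mfderiv I I' φ p (shapeOperator cov φ ξ p v)) := by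
  have hJξ := hξ.smooth.clm_apply hJ.smooth
  have hT := hJξ.tangentialPart
  have hTp : tangentialPart I I' φ p (J (φ p) (ξ p)) = (-1 : ℝ) • w := by
    rw [hξw, hJ.sq, map_neg, tangentialPart_mfderiv hφ, neg_one_smul]
  have hDf : normalConnection cov φ (fun q ↦ normalF I φ J q (ξ q)) p v
      = normalPart I I' φ p (J (φ p) (covAlong I cov φ ξ p v))
        + secondFundamentalForm cov φ p v w :=
    calc
      _ = normalPart I I' φ p (covAlong I cov φ (fun q ↦ J (φ q) (ξ q)) p v
            - covAlong I cov φ (fun q ↦ mfderiv I I' φ q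
              (tangentialPart I I' φ q (J (φ q) (ξ q)))) p v) :=
        congrArg _ (covAlong_sub cov hJξ (hT.mfderiv hφ.smooth) v)
      _ = _ := by
        rw [normalPart_sub, hJ.covAlong_apply hξ.smooth, normalPart_covAlong_mfderiv hφ hT, hTp,
          secondFundamentalForm_smul_right hφ, neg_one_smul, sub_neg_eq_add]
  have hfD : normalF I φ J p (normalConnection cov φ ξ p v)
      = normalPart I I' φ p (J (φ p) (covAlong I cov φ ξ p v))
        + J (φ p) (mfderiv I I' φ p (shapeOperator cov φ ξ p v)) := by
    rw [normalConnection_eq_covAlong_add, normalF, map_add, normalPart_add,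
      normalPart_eq_self (hreal p _)]
  exact add_left_cancel (hDf.symm.trans ((hf ξ hξ p v).trans hfD))

lemma tangentProduct_eq_shapeOperator (hJ : IsKaehlerStructure cov J)
    (hφ : IsIsometricImmersion I I' φ) (hreal : IsTotallyReal I φ J)
    (hf : HasParallelNormalFStructure I cov φ J) (hξ : IsNormalField I I' φ ξ)
    {w : TangentSpace I p} (hξw : ξ p = J (φ p) (mfderiv I I' φ p w)) (v : TangentSpace I p) :
    tangentProduct cov φ J p v w = shapeOperator cov φ ξ p v := by
  rw [tangentProduct, secondFundamentalForm_eq_of_parallel hJ hφ hreal hf hξ hξw, hJ.sq, map_neg,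
    neg_neg, tangentialPart_mfderiv hφ]

lemma secondFundamentalForm_eq_tangentProduct (hJ : IsKaehlerStructure cov J)
    (hφ : IsIsometricImmersion I I' φ) (hreal : IsTotallyReal I φ J)
    (hf : HasParallelNormalFStructure I cov φ J) (v w : TangentSpace I p) :
    secondFundamentalForm cov φ p v w
      = J (φ p) (mfderiv I I' φ p (tangentProduct cov φ J p v w)) := by
  obtain ⟨ξ, hξ, hξw⟩ := hφ.exists_isNormalField_apply_eq (hreal p w)
  rw [tangentProduct_eq_shapeOperator hJ hφ hreal hf hξ hξw,
    secondFundamentalForm_eq_of_parallel hJ hφ hreal hf hξ hξw]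

lemma inner_tangentProduct_left (hcov : IsLeviCivita cov) (hJ : IsKaehlerStructure cov J)
    (hφ : IsIsometricImmersion I I' φ) (hreal : IsTotallyReal I φ J)
    (hf : HasParallelNormalFStructure I cov φ J) (u v w : TangentSpace I p) :
    ⟪tangentProduct cov φ J p u v, w⟫ = ⟪u, tangentProduct cov φ J p w v⟫ := by
  obtain ⟨ξ, hξ, hξv⟩ := hφ.exists_isNormalField_apply_eq (hreal p v)
  rw [tangentProduct_eq_shapeOperator hJ hφ hreal hf hξ hξv,
    tangentProduct_eq_shapeOperator hJ hφ hreal hf hξ hξv, hcov.inner_shapeOperator_comm hφ hξ]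

lemma tangentProduct_right_comm (hJ : IsKaehlerStructure cov J)
    (hφ : IsIsometricImmersion I I' φ) (hreal : IsTotallyReal I φ J)
    (hcomm : HasCommutativeSecondFundamentalForms I cov φ)
    (hf : HasParallelNormalFStructure I cov φ J) (u v w : TangentSpace I p) :
    tangentProduct cov φ J p (tangentProduct cov φ J p u v) w
      = tangentProduct cov φ J p (tangentProduct cov φ J p u w) v := by
  obtain ⟨ξ, hξ, hξv⟩ := hφ.exists_isNormalField_apply_eq (hreal p v)
  obtain ⟨η, hη, hηw⟩ := hφ.exists_isNormalField_apply_eq (hreal p w)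
  simp only [tangentProduct_eq_shapeOperator hJ hφ hreal hf hξ hξv,
    tangentProduct_eq_shapeOperator hJ hφ hreal hf hη hηw]
  exact hcomm η ξ hη hξ p u

lemma meanCurvature_eq_of_parallel (hJ : IsKaehlerStructure cov J)
    (hφ : IsIsometricImmersion I I' φ) (hreal : IsTotallyReal I φ J)
    (hf : HasParallelNormalFStructure I cov φ J) :
    meanCurvature I cov φ p = J (φ p) (mfderiv I I' φ p ((finrank ℝ E : ℝ)⁻¹ •
      ∑ i, tangentProduct cov φ J p (stdOrthonormalBasis ℝ (TangentSpace I p) i)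
        (stdOrthonormalBasis ℝ (TangentSpace I p) i))) := by
  simp only [meanCurvature, secondFundamentalForm_eq_tangentProduct hJ hφ hreal hf, map_smul,
    map_sum]

theorem IsComplexSpaceForm.inner_normalCurvature (hN : IsComplexSpaceForm cov J μ)
    (hφ : IsIsometricImmersion I I' φ) (hreal : IsTotallyReal I φ J)
    (hcomm : HasCommutativeSecondFundamentalForms I cov φ) {X Y : Π p : M, TangentSpace I p}
    (hX : IsSmoothField X) (hY : IsSmoothField Y) (hξ : IsNormalField I I' φ ξ)
    (hξY : ξ p = J (φ p) (mfderiv I I' φ p (Y p))) (hXY : ⟪X p, Y p⟫ = 0) :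
    ⟪normalCurvature cov φ X Y ξ p, J (φ p) (mfderiv I I' φ p (X p))⟫
      = μ / 4 * (⟪X p, X p⟫ * ⟪Y p, Y p⟫) := by
  obtain ⟨η, hη, hηX⟩ := hφ.exists_isNormalField_apply_eq (hreal p (X p))
  rw [← hηX, hN.leviCivita.inner_normalCurvature_of_commute hφ hcomm hξ hη hX hY, hηX, hξY,
    hN.kaehler.curvatureTensor_apply hN.leviCivita.smooth hN.leviCivita.torsion_free,
    hN.kaehler.orthogonal,
    hN.inner_curvatureTensor_of_inner_eq_zero ((hφ.isometric p _ _).trans hXY)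
      (by rw [real_inner_comm, hreal]), hφ.isometric, hφ.isometric]

theorem IsComplexSpaceForm.meanCurvature_eq_zero (hN : IsComplexSpaceForm cov J μ) (hμ : μ ≠ 0)
    (hdim : 1 < finrank ℝ E) (hφ : IsIsometricImmersion I I' φ) (hreal : IsTotallyReal I φ J)
    (hcomm : HasCommutativeSecondFundamentalForms I cov φ)
    (hf : HasParallelNormalFStructure I cov φ J) (hH : HasSemiparallelMeanCurvature I cov φ)
    (p : M) : meanCurvature I cov φ p = 0 := by
  have hHp := meanCurvature_eq_of_parallel (p := p) hN.kaehler hφ hreal hf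
  obtain ⟨Y, hY, hYp⟩ := exists_isSmoothField_apply_eq I p ((finrank ℝ E : ℝ)⁻¹ •
    ∑ i, tangentProduct cov φ J p (stdOrthonormalBasis ℝ (TangentSpace I p) i)
      (stdOrthonormalBasis ℝ (TangentSpace I p) i))
  rw [← hYp] at hHp
  obtain ⟨x, hx, hxY⟩ : ∃ x : TangentSpace I p, x ≠ 0 ∧ ⟪x, Y p⟫ = 0 :=
    exists_ne_zero_inner_eq_zero hdim (Y p)
  obtain ⟨X, hX, rfl⟩ := exists_isSmoothField_apply_eq I p x
  have hR := hN.inner_normalCurvature hφ hreal hcomm hX hY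
    (hN.leviCivita.isNormalField_meanCurvature hφ) hHp hxY
  rw [hH X Y hX hY, inner_zero_left] at hR
  have hYY : ⟪Y p, Y p⟫ = 0 := by simpa [hμ, hx] using hR.symm
  rw [hHp, inner_self_eq_zero.1 hYY, map_zero, map_zero]

lemma secondFundamentalForm_eq_zero_of_meanCurvature_eq_zero (hcov : IsLeviCivita cov)
    (hJ : IsKaehlerStructure cov J) (hφ : IsIsometricImmersion I I' φ)
    (hreal : IsTotallyReal I φ J) (hcomm : HasCommutativeSecondFundamentalForms I cov φ)
    (hf : HasParallelNormalFStructure I cov φ J) (hH : meanCurvature I cov φ p = 0)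
    (v w : TangentSpace I p) : secondFundamentalForm cov φ p v w = 0 := by
  let b := stdOrthonormalBasis ℝ (TangentSpace I p)
  have hσ := secondFundamentalForm_eq_tangentProduct (p := p) hJ hφ hreal hf
  have hsum_σ : ∑ i, secondFundamentalForm cov φ p (b i) (b i) = 0 := by
    refine (smul_eq_zero.1 hH).elim (fun hdim ↦ ?_) id
    exact Finset.sum_eq_zero fun i _ ↦ absurd (Nat.cast_eq_zero.1 (inv_eq_zero.1 hdim)) i.pos.ne'
  have hsum : ∑ i, tangentProduct cov φ J p (b i) (b i) = 0 := by
    refine (inner_self_eq_zero (𝕜 := ℝ)).1 ?_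
    simp only [hσ, ← map_sum] at hsum_σ
    rw [← hφ.isometric, ← hJ.orthogonal, hsum_σ, inner_zero_left]
  rw [hσ, eq_zero_of_sum_apply_self_eq_zero (tangentProduct_comm hcov.torsion_free hφ)
    (inner_tangentProduct_left hcov hJ hφ hreal hf)
    (tangentProduct_right_comm hJ hφ hreal hcomm hf) b hsum, map_zero, map_zero]

end TotallyReal

theorem proposition3_general
    {E : Type*} [NormedAddCommGroup E] [NormedSpace ℝ E] [FiniteDimensional ℝ E]
    (hdim : 1 < finrank ℝ E) {H : Type*} [TopologicalSpace H] {I : ModelWithCorners ℝ E H}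
    {E' : Type*} [NormedAddCommGroup E'] [NormedSpace ℝ E'] [FiniteDimensional ℝ E']
    {H' : Type*} [TopologicalSpace H'] {I' : ModelWithCorners ℝ E' H'}
    {N : Type*} [TopologicalSpace N] [T2Space N] [ChartedSpace H' N] [IsManifold I' ∞ N]
    [RiemannianBundle (fun x : N ↦ TangentSpace I' x)]
    [IsContMDiffRiemannianBundle I' ∞ E' (fun x : N ↦ TangentSpace I' x)]
    {M : Type*} [TopologicalSpace M] [T2Space M] [ChartedSpace H M] [IsManifold I ∞ M]
    [RiemannianBundle (fun x : M ↦ TangentSpace I x)]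
    [IsContMDiffRiemannianBundle I ∞ E (fun x : M ↦ TangentSpace I x)]
    {cov : CovariantDerivative I' E' (fun x : N ↦ TangentSpace I' x)}
    {J : Π x : N, TangentSpace I' x →L[ℝ] TangentSpace I' x}
    {μ : ℝ} (hN : IsComplexSpaceForm cov J μ) {φ : M → N} (hφ : IsIsometricImmersion I I' φ)
    (hreal : IsTotallyReal I φ J) (hcomm : HasCommutativeSecondFundamentalForms I cov φ)
    (hf : HasParallelNormalFStructure I cov φ J) (hH : HasSemiparallelMeanCurvature I cov φ) :
    IsTotallyGeodesic I cov φ ∨ μ = 0 := by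
  by_cases hμ : μ = 0
  · exact Or.inr hμ
  · refine Or.inl fun p v w ↦ ?_
    have hmean := hN.meanCurvature_eq_zero hμ hdim hφ hreal hcomm hf hH p
    exact secondFundamentalForm_eq_zero_of_meanCurvature_eq_zero hN.leviCivita hN.kaehler hφ
      hreal hcomm hf hmean v w

theorem proposition3 {m n : ℕ} (hn : 1 < n)
    {N : Type*} [TopologicalSpace N] [T2Space N]
    [ChartedSpace (EuclideanSpace ℝ (Fin (2 * m))) N] [IsManifold (𝓡 (2 * m)) ∞ N]
    [RiemannianBundle (fun x : N ↦ TangentSpace (𝓡 (2 * m)) x)]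
    [IsContMDiffRiemannianBundle (𝓡 (2 * m)) ∞ (EuclideanSpace ℝ (Fin (2 * m)))
      (fun x : N ↦ TangentSpace (𝓡 (2 * m)) x)]
    {M : Type*} [TopologicalSpace M] [T2Space M]
    [ChartedSpace (EuclideanSpace ℝ (Fin n)) M] [IsManifold (𝓡 n) ∞ M]
    [RiemannianBundle (fun x : M ↦ TangentSpace (𝓡 n) x)]
    [IsContMDiffRiemannianBundle (𝓡 n) ∞ (EuclideanSpace ℝ (Fin n))
      (fun x : M ↦ TangentSpace (𝓡 n) x)]
    (cov : CovariantDerivative (𝓡 (2 * m)) (EuclideanSpace ℝ (Fin (2 * m)))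
      (fun x : N ↦ TangentSpace (𝓡 (2 * m)) x))
    (J : Π x : N, TangentSpace (𝓡 (2 * m)) x →L[ℝ] TangentSpace (𝓡 (2 * m)) x)
    (μ : ℝ) (hN : IsComplexSpaceForm cov J μ)
    (φ : M → N) (hφ : IsIsometricImmersion (𝓡 n) (𝓡 (2 * m)) φ)
    (hreal : IsTotallyReal (𝓡 n) φ J)
    (hcomm : HasCommutativeSecondFundamentalForms (𝓡 n) cov φ)
    (hf : HasParallelNormalFStructure (𝓡 n) cov φ J)
    (hH : HasSemiparallelMeanCurvature (𝓡 n) cov φ) :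
    IsTotallyGeodesic (𝓡 n) cov φ ∨ μ = 0 :=
  proposition3_general (by rwa [finrank_euclideanSpace_fin]) hN hφ hreal hcomm hf hH
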